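/- Let $\sigma_s>0$, $0<\Delta<\sigma_s^2$, $\sigma_r^2=\sigma_s^2-\Delta$, $\alpha=\sigma_r^2/\sigma_s^2$, $\tilde\sigma_\Delta^2=\sigma_r^2\Delta/\sigma_s^2$, let $0<\beta'<\beta<\tfrac12$ and let $0<c\le C$. Let $N=2^m$, let $\eta>0$ and $r\in\mathbb{N}$ satisfy $\eta 2^r=\sqrt N$ and $cN\le 1/\eta^2\le CN$, and let $G_N=\left[\begin{smallmatrix}1&0\\1&1\end{smallmatrix}\right]^{\otimes m}$ over $\mathbb{F}_2$. Test channel: let $(X^j,Y'^j)$, $1\le j\le N$, be i.i.d. copies of $(X,Y')$, where $X$ has the discrete Gaussian law on $\eta\mathbb{Z}$, $P(X=\eta k)\propto e^{-\eta^2k^2/(2\sigma_r^2)}$, and $Y'-X$ is independent of $X$ and $\mathcal N(0,\Delta)$-distributed. Let $X_1^j,\dots,X_r^j\in\{0,1\}$ be defined by $X^j/\eta\equiv\sum_{\ell=1}^r2^{\ell-1}X_\ell^j \pmod{2^r}$, and put $U_\ell^{[N]}=X_\ell^{[N]}G_N$. Write $P$ for the resulting joint law, and for a bit $B$ and a random variable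 $S$, $Z(B|S)=2\int\sqrt{P_{B,S}(0,s)P_{B,S}(1,s)}\,ds$ (a sum over the discrete components of $S$). For each level $\ell$ let $$\mathcal I_\ell=\{i\in[N]: Z(U_\ell^i\,|\,U_\ell^{1:i-1},X_{1:\ell-1}^{[N]},Y'^{[N]})<1-2^{-N^\beta}\},\qquad \mathcal F_\ell=[N]\setminus\mathcal I_\ell .$$ Quantizer: let $u^{\mathcal F}=(u_\ell^i)_{1\le\ell\le r,\,i\in\mathcal F_\ell}$ be a choice of all the frozen bits (it fixes the shift of the polar lattice quantizer). Given $y\in\mathbb{R}^N$, the quantizer determines bits $u_\ell^i$ for $\ell=1,\dots,r$ and, within each level, $i=1,\dots,N$: if $i\in\mathcal F_\ell$ the bit is the prescribed frozen bit, and if $i\in\mathcal I_\ell$ it is $b\in\{0,1\}$ with probability $P(U_\ell^i=b\,|\,u_\ell^{1:i-1},x_{1:\ell-1}^{[N]},y)$, where $x_\ell^{[N]}=u_\ell^{[N]}G_N$. The output $x\in(\eta\mathbb{Z})^N$ has as its $j$-th coordinate the point nearest to $\alpha y^j$ in the coset $\eta\sum_{\ell=1}^r2^{\ell-1}x_\ell^j+\eta2^r\mathbb{Z}$.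 Apply this quantizer, with $u^{\mathcal F}$ fixed, to a vector $Y^{[N]}$ of $N$ i.i.d. $\mathcal N(0,\sigma_s^2)$ variables, let $X^{[N]}$ be its output, and let $$D(u^{\mathcal F})=\mathsf E_{Q|u^{\mathcal F}}\Big[\tfrac1N\|\alpha Y^{[N]}-X^{[N]}\|^2\Big]$$ be the expected distortion over $Y^{[N]}$ and the random choices of the quantizer (for every $u^{\mathcal F}$ this expectation is finite). Theorem. There is an $N_0$, depending only on $\sigma_s,\Delta,\beta,\beta',c,C$, such that for all $N=2^m\ge N_0$ and all $\eta,r$ as above, if the frozen bits $u^{\mathcal F}$ are drawn uniformly at random from all possible choices, then $$\mathsf{Prob}\Big(D(u^{\mathcal F})\le\tilde\sigma_\Delta^2+2N2^{-N^{\beta'}}+N^{2/3}2^{-\frac13N^{\beta'}}\Big)\ \ge\ 1-N^{2/3}2^{-\frac13N^{\beta'}} .$$ -/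

import Mathlib

open MeasureTheory ProbabilityTheory Filter

noncomputable section

namespace PolarQuantizer

/-! ### The polar transform -/

/-- `G_N = [[1,0],[1,1]]^{⊗ m}` over `𝔽₂`, with `N = 2 ^ m`: the `m`-fold Kronecker power,
rows and columns being numbered `0, …, N - 1` in the usual (block) order. -/
def polarG : (m : ℕ) → Matrix (Fin (2 ^ m)) (Fin (2 ^ m)) (ZMod 2)
  | 0 => 1
  | m + 1 =>
    let e : Fin 2 × Fin (2 ^ m) ≃ Fin (2 ^ (m + 1)) :=
      finProdFinEquiv.trans (finCongr (pow_succ' 2 m).symm)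
    Matrix.reindex e e (Matrix.kronecker !![1, 0; 1, 1] (polarG m))

/-- The pairs (level, position), in the order in which the bits are decided: level by level,
and inside a level from the first to the last position.  Levels and positions are numbered
from `0`. -/
abbrev BitIdx (m r : ℕ) : Type := Fin r ×ₗ Fin (2 ^ m)

/-- The bits `u_ℓ^i` of all `r` levels. -/
abbrev Bits (m r : ℕ) : Type := BitIdx m r → ZMod 2

/-- The binary labels `x_ℓ^{[N]} = u_ℓ^{[N]} G_N` (recall `G_N⁻¹ = G_N` over `𝔽₂`). -/
def labels {m r : ℕ} (u : Bits m r) (l : Fin r) (j : Fin (2 ^ m)) : ZMod 2 :=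
  Matrix.vecMul (fun i => u (toLex (l, i))) (polarG m) j

/-- The integer in `{0, …, 2 ^ r - 1}` whose binary digits are the labels of coordinate `j`;
it names the coset `η * cosetRep + η 2 ^ r ℤ` of `η 2 ^ r ℤ` in `η ℤ`. -/
def cosetRep {m r : ℕ} (u : Bits m r) (j : Fin (2 ^ m)) : ℕ :=
  ∑ l : Fin r, 2 ^ (l : ℕ) * (labels u l j).val

/-! ### The test channel with discrete Gaussian input

`σs ^ 2` is the source variance, `Δ` the target distortion, `σ_r ^ 2 = σs ^ 2 - Δ` the
variance of the reconstruction. -/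

/-- The MMSE coefficient `α = σ_r ^ 2 / σs ^ 2`. -/
def mmse (σs Δ : ℝ) : ℝ := (σs ^ 2 - Δ) / σs ^ 2

/-- `σ̃_Δ ^ 2 = σ_r ^ 2 Δ / σs ^ 2`. -/
def mmseVar (σs Δ : ℝ) : ℝ := (σs ^ 2 - Δ) * Δ / σs ^ 2

/-- The discrete Gaussian `D_{η ℤ, σ_r}`: the mass of the lattice point `η k`. -/
def discreteGaussian (σs Δ η : ℝ) (k : ℤ) : ℝ :=
  gaussianPDFReal 0 (σs ^ 2 - Δ).toNNReal (η * k) /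
    ∑' t : ℤ, gaussianPDFReal 0 (σs ^ 2 - Δ).toNNReal (η * t)

/-- The joint density at `y` of the event that `X` lies in the coset `η c + η 2 ^ r ℤ`, and of
`Y' = X + noise`, where `X ∼ D_{η ℤ, σ_r}` and the independent noise is Gaussian with
variance `Δ`. -/
def cosetDensity (σs Δ η : ℝ) (r c : ℕ) (y : ℝ) : ℝ :=
  ∑' t : ℤ, discreteGaussian σs Δ η (c + 2 ^ r * t) *
    gaussianPDFReal (η * ((c + 2 ^ r * t : ℤ) : ℝ)) Δ.toNNReal y

/-- The joint density of `(U_{1:r}^{[N]}, Y'^{[N]})` for `N` independent uses of the test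
channel, `U_ℓ^{[N]} = X_ℓ^{[N]} G_N`. -/
def jointDensity (σs Δ η : ℝ) {m r : ℕ} (u : Bits m r) (y : Fin (2 ^ m) → ℝ) : ℝ :=
  ∏ j, cosetDensity σs Δ η r (cosetRep u j) (y j)

open Classical in
/-- The joint density of the event that the bits before `p` equal `w` and the bit at `p` equals
`b`, and of `Y'^{[N]}` at `y`.  For `p = (ℓ, i)` the bits before `p` are `u_{1:ℓ-1}^{[N]}`
(equivalently `x_{1:ℓ-1}^{[N]}`) and `u_ℓ^{1:i-1}`. -/
def bitDensity (σs Δ η : ℝ) {m r : ℕ} (p : BitIdx m r) (w : Set.Iio p → ZMod 2) (b : ZMod 2)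
    (y : Fin (2 ^ m) → ℝ) : ℝ :=
  ∑ u : Bits m r with (∀ q : Set.Iio p, u q = w q) ∧ u p = b, jointDensity σs Δ η u y

/-- The conditional probability `P (b | u_ℓ^{1:i-1}, x_{1:ℓ-1}^{[N]}, y^{[N]})`. -/
def bitPosterior (σs Δ η : ℝ) {m r : ℕ} (p : BitIdx m r) (w : Set.Iio p → ZMod 2) (b : ZMod 2)
    (y : Fin (2 ^ m) → ℝ) : ℝ :=
  bitDensity σs Δ η p w b y / (bitDensity σs Δ η p w 0 y + bitDensity σs Δ η p w 1 y)

open Classical in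
/-- The Bhattacharyya parameter
`Z (U_ℓ^i | U_ℓ^{1:i-1}, X_{1:ℓ-1}^{[N]}, Y'^{[N]})` at `p = (ℓ, i)`. -/
def bhattacharyya (σs Δ η : ℝ) {m r : ℕ} (p : BitIdx m r) : ℝ :=
  2 * ∑ w : Set.Iio p → ZMod 2,
    ∫ y : Fin (2 ^ m) → ℝ, √(bitDensity σs Δ η p w 0 y * bitDensity σs Δ η p w 1 y)

/-! ### The quantizer -/

/-- The information sets of all levels, as one set of pairs (level, position). -/
def infoSet (σs Δ η β : ℝ) (m r : ℕ) : Set (BitIdx m r) :=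
  {p | bhattacharyya σs Δ η p < 1 - (2 : ℝ) ^ (-((2 ^ m : ℝ) ^ β))}

/-- The frozen sets of all levels: the complement of the information sets. -/
def frozenSet (σs Δ η β : ℝ) (m r : ℕ) : Set (BitIdx m r) := (infoSet σs Δ η β m r)ᶜ

/-- A choice of all the frozen bits. -/
abbrev FrozenBits (σs Δ η β : ℝ) (m r : ℕ) : Type := frozenSet σs Δ η β m r → ZMod 2

open Classical in
/-- The probability that the randomized quantizer, run on the source vector `y` with the frozen
bits fixed to `f`, produces the bits `u`: a frozen bit is copied from `f`, an information bit is
drawn from its conditional probability given `y` and the bits decided before it. -/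
def encoderProb {σs Δ η β : ℝ} {m r : ℕ} (f : FrozenBits σs Δ η β m r) (y : Fin (2 ^ m) → ℝ)
    (u : Bits m r) : ℝ :=
  ∏ p : BitIdx m r,
    if h : p ∈ frozenSet σs Δ η β m r then (if u p = f ⟨p, h⟩ then 1 else 0)
    else bitPosterior σs Δ η p (fun q => u q) (u p) y

/-- The reconstruction point: in each coordinate, the point nearest to `α y` in the coset of
`η 2 ^ r ℤ` that the labels of the `r` levels name. -/
def reconstruct (σs Δ η : ℝ) {m r : ℕ} (u : Bits m r) (y : Fin (2 ^ m) → ℝ)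
    (j : Fin (2 ^ m)) : ℝ :=
  η * cosetRep u j +
    η * 2 ^ r * round ((mmse σs Δ * y j - η * cosetRep u j) / (η * 2 ^ r))

/-- The distortion per dimension `N⁻¹ ‖α y - x‖ ^ 2`. -/
def distortion (σs Δ η : ℝ) {m r : ℕ} (u : Bits m r) (y : Fin (2 ^ m) → ℝ) : ℝ :=
  1 / (2 ^ m : ℝ) * ∑ j, (mmse σs Δ * y j - reconstruct σs Δ η u y j) ^ 2

/-- The distortion of the source vector `y` for the frozen bits `f`, averaged over the random
choices of the quantizer. -/
def meanDistortion {σs Δ η β : ℝ} {m r : ℕ} (f : FrozenBits σs Δ η β m r)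
    (y : Fin (2 ^ m) → ℝ) : ℝ :=
  ∑ u : Bits m r, encoderProb f y u * distortion σs Δ η u y

/-- The law of the source `Y^{[N]}`: `N` independent Gaussians of mean `0`, variance `σs ^ 2`. -/
def sourceLaw (σs : ℝ) (m : ℕ) : Measure (Fin (2 ^ m) → ℝ) :=
  Measure.pi fun _ => gaussianReal 0 (σs ^ 2).toNNReal

/-- `E_{Q | u^F} [N⁻¹ ‖α Y - X‖ ^ 2]`: the expected distortion when the frozen bits are `f`. -/
def expectedDistortion {σs Δ η β : ℝ} {m r : ℕ} (f : FrozenBits σs Δ η β m r) : ℝ :=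
  ∫ y, meanDistortion f y ∂(sourceLaw σs m)

/-- The probability of `S` for a uniformly distributed element of a finite type. -/
def uniformProb {A : Type} (S : Set A) : ℝ := (S.ncard : ℝ) / Nat.card A

end PolarQuantizer

end

/-! ### Sequential sampling of bits -/

namespace PolarQuantizer

section Sequential

variable {ι : Type*} [LinearOrder ι]

/-! Write G for the density of the source vector, F for that of the test-channel output, W_u for the
joint density of the test channel at the bit string u, and S_u(y) for the probability that the
quantizer with uniform frozen bits produces u from y. The quantizer has joint law G·S_u. It is
compared with F·S_u and then with W_u, under which the distortion can be computed.

F is close to G. After completing the square, F/G is in each coordinate a ratio of two lattice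
Gaussian sums. By Poisson summation this ratio differs from 1 by O(q), q = exp(-2π²σ̃²/η²),
uniformly in y (`abs_outputDensity_sub_le`). Since 1/η² ≥ cN, the error stays exponentially small
after N coordinates.

F·S_u is close to W_u in total variation. By the chain rule both are products of conditional bit
laws, and these differ only at frozen positions. Exchanging them one at a time costs ∑_w |P(w,0) -
P(w,1)| per frozen position (`sum_abs_sub_samplerDensity_le`). A Bhattacharyya parameter near 1
makes this small (`integral_samplerGap_le`).

Under W_u the nearest point of the coset is no farther from αy than the lattice point actually sent.
The error of the latter is a combination of the output power and of the total mass, one coset at a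
time (`integral_sq_cosetError_mul_le`). Since this holds for every single u, it survives
conditioning on the frozen bits f. That conditioning leaves the output law F unchanged, so the power
is at most (1+e)σs², where e bounds the relative error of F against G, and the main term is exactly
σ̃² (`expectedDistortion_le`).

Each f thus has excess distortion at most a small constant plus the normalized sum of nonnegative
losses over the strings u compatible with f. The average of these sums over f is the total loss over
all u. It is at most a polynomial in N times 2^(-N^β/4): the distortion is at most (η2^r)²/4 = N/4,
and the unbounded power is controlled by a fourth moment (`sum_outputLoss_le`). As β' < β, this is
eventually below the square of the allowed deviation, and Markov's inequality concludes. -/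

/-- Flip the bit at position `p`. -/
def flipBit (p : ι) (u : ι → ZMod 2) : ι → ZMod 2 := Function.update u p (u p + 1)

theorem zmod_two_add_one_add_one (a : ZMod 2) : a + 1 + 1 = a := by
  revert a; decide

theorem flipBit_flipBit (p : ι) (u : ι → ZMod 2) : flipBit p (flipBit p u) = u := by
  simp [flipBit, zmod_two_add_one_add_one]

theorem flipBit_of_ne {p q : ι} (h : q ≠ p) (u : ι → ZMod 2) : flipBit p u q = u q := by
  simp [flipBit, h]

/-- A family of conditional densities of the bits given the preceding ones, relative to the
uniform distribution on bits. -/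
structure IsBitKernel (A : ι → (ι → ZMod 2) → ℝ) : Prop where
  nonneg : ∀ p u, 0 ≤ A p u
  add_flip : ∀ p u, A p u + A p (flipBit p u) = 2
  flip_of_lt : ∀ p q u, p < q → A p (flipBit q u) = A p u

theorem IsBitKernel.prod_flip {A : ι → (ι → ZMod 2) → ℝ} (hA : IsBitKernel A) {p : ι}
    {s : Finset ι} (hs : ∀ q ∈ s, q < p) (u : ι → ZMod 2) :
    ∏ q ∈ s, A q (flipBit p u) = ∏ q ∈ s, A q u :=
  Finset.prod_congr rfl fun q hq => hA.flip_of_lt _ _ _ (hs q hq)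

variable [Fintype ι]

theorem sum_flipBit (p : ι) (h : (ι → ZMod 2) → ℝ) : ∑ u, h (flipBit p u) = ∑ u, h u :=
  Equiv.sum_comp (Function.Involutive.toPerm _ (flipBit_flipBit p)) h

/-- Pairing each string with its flip at `p` replaces the kernel by its mean 1. -/
theorem IsBitKernel.sum_mul {A : ι → (ι → ZMod 2) → ℝ} (hA : IsBitKernel A) (p : ι)
    (h : (ι → ZMod 2) → ℝ) (hh : ∀ u, h (flipBit p u) = h u) :
    ∑ u, h u * A p u = ∑ u, h u := by
  have h1 := sum_flipBit p (fun u => h u * A p u)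
  have h2 : ∑ u, (h u * A p u + h (flipBit p u) * A p (flipBit p u)) = ∑ u, 2 * h u := by
    refine Finset.sum_congr rfl fun u _ => ?_
    rw [hh, ← mul_add, hA.add_flip]; ring
  rw [Finset.sum_add_distrib, h1, ← Finset.mul_sum] at h2
  linarith

/-- Kernels are averaged out from the last position to the first: flipping the last bit affects
neither `h` nor the kernels at earlier positions. -/
theorem IsBitKernel.sum_mul_prod {A : ι → (ι → ZMod 2) → ℝ} (hA : IsBitKernel A)
    (s : Finset ι) (h : (ι → ZMod 2) → ℝ) (hh : ∀ p ∈ s, ∀ u, h (flipBit p u) = h u) :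
    ∑ u, h u * ∏ p ∈ s, A p u = ∑ u, h u := by
  induction s using Finset.induction_on_max with
  | empty => simp
  | insert a s hs ih =>
    rw [← ih fun p hp => hh p (Finset.mem_insert_of_mem hp),
      ← hA.sum_mul a (fun u => h u * ∏ p ∈ s, A p u)]
    · refine Finset.sum_congr rfl fun u _ => ?_
      rw [Finset.prod_insert fun ha => lt_irrefl _ (hs a ha)]; ring
    · intro u
      rw [hh a (Finset.mem_insert_self _ _), hA.prod_flip hs]

/-- Replacing the conditional densities one at a time. -/
theorem IsBitKernel.sum_abs_prod_sub_prod_le {A B : ι → (ι → ZMod 2) → ℝ} (hA : IsBitKernel A)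
    (hB : IsBitKernel B) (s : Finset ι) :
    ∑ u, |∏ p ∈ s, A p u - ∏ p ∈ s, B p u| ≤
      ∑ p ∈ s, ∑ u, (∏ q ∈ s with q < p, A q u) * |A p u - B p u| := by
  induction s using Finset.induction_on_max with
  | empty => simp
  | insert a s hs ih =>
    have ha : a ∉ s := fun ha => lt_irrefl _ (hs a ha)
    have hfa : (insert a s).filter (· < a) = s := by
      ext q; simp only [Finset.mem_filter, Finset.mem_insert]
      constructor
      · rintro ⟨rfl | h, h'⟩
        · exact absurd h' (lt_irrefl _)
        · exact h
      · exact fun h => ⟨Or.inr h, hs q h⟩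
    have hfp : ∀ p ∈ s, (insert a s).filter (· < p) = s.filter (· < p) := by
      intro p hp
      rw [Finset.filter_insert, if_neg (not_lt.2 (hs p hp).le)]
    rw [Finset.sum_insert ha, hfa]
    have hrest : ∑ p ∈ s, ∑ u, (∏ q ∈ insert a s with q < p, A q u) * |A p u - B p u| =
        ∑ p ∈ s, ∑ u, (∏ q ∈ s with q < p, A q u) * |A p u - B p u| :=
      Finset.sum_congr rfl fun p hp => by rw [hfp p hp]
    rw [hrest]
    -- The old difference does not see bit `a`, so the last kernel of `B` averages to 1 and the
    -- induction hypothesis applies.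
    have key : ∑ u, |∏ p ∈ s, A p u - ∏ p ∈ s, B p u| * B a u =
        ∑ u, |∏ p ∈ s, A p u - ∏ p ∈ s, B p u| :=
      hB.sum_mul a _ fun u => by rw [hA.prod_flip hs, hB.prod_flip hs]
    refine le_trans ?_ (add_le_add_right (key.le.trans ih) _)
    rw [← Finset.sum_add_distrib]
    refine Finset.sum_le_sum fun u _ => ?_
    rw [Finset.prod_insert ha, Finset.prod_insert ha]
    have h1 : A a u * ∏ p ∈ s, A p u - B a u * ∏ p ∈ s, B p u =
        (∏ p ∈ s, A p u) * (A a u - B a u) +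
          (∏ p ∈ s, A p u - ∏ p ∈ s, B p u) * B a u := by ring
    rw [h1]
    refine (abs_add_le _ _).trans (le_of_eq ?_)
    rw [abs_mul, abs_mul, abs_of_nonneg (hB.nonneg a u),
      abs_of_nonneg (Finset.prod_nonneg fun p _ => hA.nonneg p u)]

/-! ### Conditional bit laws of a positive weight -/

open Classical in
/-- The weight of the bit strings with prefix `w` before `p` and bit `b` at `p`. -/
noncomputable def prefixWeight (W : (ι → ZMod 2) → ℝ) (p : ι) (w : Set.Iio p → ZMod 2)
    (b : ZMod 2) : ℝ :=
  ∑ u : ι → ZMod 2 with (∀ q : Set.Iio p, u q = w q) ∧ u p = b, W u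

/-- Twice the conditional probability of the bit `u p` given the bits before `p`. -/
noncomputable def bitRatio (W : (ι → ZMod 2) → ℝ) (p : ι) (u : ι → ZMod 2) : ℝ :=
  2 * (prefixWeight W p (fun q => u q) (u p) /
    (prefixWeight W p (fun q => u q) 0 + prefixWeight W p (fun q => u q) 1))

theorem prefixWeight_pos {W : (ι → ZMod 2) → ℝ} (hW : ∀ u, 0 < W u) (p : ι)
    (w : Set.Iio p → ZMod 2) (b : ZMod 2) : 0 < prefixWeight W p w b := by
  classical
  refine Finset.sum_pos (fun u _ => hW u)
    ⟨fun q => if h : q < p then w ⟨q, h⟩ else b, ?_⟩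
  simp only [Finset.mem_filter, Finset.mem_univ, true_and, lt_irrefl, dite_false, and_true]
  intro q
  have hq : (q : ι) < p := q.2
  simp [hq]

theorem isBitKernel_bitRatio {W : (ι → ZMod 2) → ℝ} (hW : ∀ u, 0 < W u) :
    IsBitKernel (bitRatio W) where
  nonneg p u := by
    have h := prefixWeight_pos hW p fun q => u q
    have := h (u p)
    have := h 0
    have := h 1
    unfold bitRatio; positivity
  add_flip p u := by
    have h0 := prefixWeight_pos hW p (fun q => u q) 0
    have h1 := prefixWeight_pos hW p (fun q => u q) 1
    have he : (fun q : Set.Iio p => flipBit p u q) = fun q : Set.Iio p => u q :=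
      funext fun q => flipBit_of_ne (ne_of_lt q.2) u
    have hp : flipBit p u p = u p + 1 := by simp [flipBit]
    unfold bitRatio
    rw [he, hp]
    have : u p = 0 ∨ u p = 1 := by generalize u p = a; revert a; decide
    rcases this with h | h
    · rw [h, zero_add]; field_simp
    · rw [h, show (1 : ZMod 2) + 1 = 0 by decide]; field_simp; ring
  flip_of_lt p q u hpq := by
    have he : (fun x : Set.Iio p => flipBit q u x) = fun x : Set.Iio p => u x :=
      funext fun x => flipBit_of_ne (ne_of_lt (lt_trans x.2 hpq)) u
    unfold bitRatio
    rw [he, flipBit_of_ne (ne_of_lt hpq)]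

theorem prefixWeight_zero_add_one (W : (ι → ZMod 2) → ℝ) (p : ι) (w : Set.Iio p → ZMod 2)
    [DecidablePred fun u : ι → ZMod 2 => ∀ q : Set.Iio p, u q = w q] :
    prefixWeight W p w 0 + prefixWeight W p w 1 =
      ∑ u : ι → ZMod 2 with (∀ q : Set.Iio p, u q = w q), W u := by
  classical
  unfold prefixWeight
  simp only [Finset.sum_filter]
  rw [← Finset.sum_add_distrib]
  refine Finset.sum_congr rfl fun u _ => ?_
  have : u p = 0 ∨ u p = 1 := by generalize u p = a; revert a; decide
  rcases this with h | h <;> by_cases hq : ∀ q : Set.Iio p, u q = w q <;> simp [h, hq]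

open Classical in
/-- The chain rule. -/
theorem prod_bitRatio {W : (ι → ZMod 2) → ℝ} (hW : ∀ u, 0 < W u) (s : Finset ι)
    (hs : ∀ p ∈ s, ∀ q < p, q ∈ s) (u : ι → ZMod 2) :
    (∏ p ∈ s, bitRatio W p u) * ∑ v, W v =
      2 ^ s.card * ∑ v : ι → ZMod 2 with (∀ q ∈ s, v q = u q), W v := by
  induction s using Finset.induction_on_max with
  | empty => simp
  | insert a s hlt ih =>
    have ha : a ∉ s := fun ha => lt_irrefl _ (hlt a ha)
    -- An initial segment with maximum `a` is everything below `a` together with `a`, so agreeing on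
    -- `s` means having the same prefix before `a`.
    have hmem : ∀ q, q ∈ s ↔ q < a := fun q =>
      ⟨hlt q, fun h => ((Finset.mem_insert.1 (hs a (Finset.mem_insert_self _ _) q h)).resolve_left
        (ne_of_lt h))⟩
    have ih := ih fun p hp q hq => (hmem q).2 (hq.trans (hlt p hp))
    rw [Finset.prod_insert ha, Finset.card_insert_of_notMem ha, mul_assoc, ih]
    have h1 : (∑ v : ι → ZMod 2 with (∀ q ∈ s, v q = u q), W v) =
        prefixWeight W a (fun q => u q) 0 + prefixWeight W a (fun q => u q) 1 := by
      rw [prefixWeight_zero_add_one]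
      refine Finset.sum_congr (Finset.filter_congr fun v _ => ?_) fun _ _ => rfl
      simp [hmem]
    have h2 : (∑ v : ι → ZMod 2 with (∀ q ∈ insert a s, v q = u q), W v) =
        prefixWeight W a (fun q => u q) (u a) := by
      unfold prefixWeight
      refine Finset.sum_congr (Finset.filter_congr fun v _ => ?_) fun _ _ => rfl
      simp [hmem, and_comm]
    rw [h1, h2]
    have h0 := prefixWeight_pos hW a (fun q => u q) 0
    have h1 := prefixWeight_pos hW a (fun q => u q) 1
    unfold bitRatio
    field_simp
    ring

/-- Every prefix before `p` has the same number of extensions, one bit being free at each remaining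
position. -/
theorem sum_restrict (p : ι) (g : (Set.Iio p → ZMod 2) → ℝ) :
    ∑ u : ι → ZMod 2, g (fun q => u q) =
      2 ^ (Fintype.card ι - (Finset.univ.filter (· < p)).card) * ∑ w, g w := by
  classical
  rw [← Equiv.sum_comp (Equiv.piEquivPiSubtypeProd (· < p) fun _ : ι => ZMod 2).symm,
    Fintype.sum_prod_type, Finset.mul_sum]
  refine Finset.sum_congr rfl fun w _ => ?_
  have : ∀ v, (fun q : Set.Iio p =>
      (Equiv.piEquivPiSubtypeProd (· < p) fun _ : ι => ZMod 2).symm (w, v) q) = w := by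
    intro v; funext q
    have hq : (q : ι) < p := q.2
    simp only [Equiv.piEquivPiSubtypeProd, Equiv.coe_fn_symm_mk, hq, dite_true]
    rfl
  simp only [this]
  rw [Finset.sum_const, Finset.card_univ, Fintype.card_fun, ZMod.card, Fintype.card_subtype_compl,
    Fintype.card_subtype, nsmul_eq_mul]
  push_cast; rfl

/-- With D0, D1 the weights of the two continuations of a prefix, the chain rule turns the product
into a multiple of D0 + D1, and (D0 + D1)·|ratio - 1| = |D0 - D1|. This evaluates the telescoping
terms when the second kernel is the uniform one. -/
theorem sum_prod_bitRatio_mul_abs {W : (ι → ZMod 2) → ℝ} (hW : ∀ u, 0 < W u) (p : ι) :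
    (∑ u, (∏ q with q < p, bitRatio W q u) * |bitRatio W p u - 1|) * ∑ v, W v =
      2 ^ Fintype.card ι * ∑ w, |prefixWeight W p w 0 - prefixWeight W p w 1| := by
  classical
  set n := (Finset.univ.filter (· < p) : Finset ι).card with hn
  have hn' : n ≤ Fintype.card ι := Finset.card_le_univ _
  have hterm : ∀ u, (∏ q with q < p, bitRatio W q u) * |bitRatio W p u - 1| * ∑ v, W v =
      2 ^ n * |prefixWeight W p (fun q => u q) 0 - prefixWeight W p (fun q => u q) 1| := by
    intro u
    have h := prod_bitRatio hW (Finset.univ.filter (· < p))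
      (fun a ha q hq => by
        simp only [Finset.mem_filter, Finset.mem_univ, true_and] at *
        exact hq.trans ha) u
    have h1 : (∑ v : ι → ZMod 2 with (∀ q ∈ Finset.univ.filter (· < p), v q = u q), W v) =
        prefixWeight W p (fun q => u q) 0 + prefixWeight W p (fun q => u q) 1 := by
      rw [prefixWeight_zero_add_one]
      refine Finset.sum_congr (Finset.filter_congr fun v _ => ?_) fun _ _ => rfl
      simp
    rw [h1] at h
    rw [mul_right_comm, h, mul_assoc]
    congr 1
    have h0 := prefixWeight_pos hW p (fun q => u q) 0
    have h1 := prefixWeight_pos hW p (fun q => u q) 1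
    unfold bitRatio
    rw [← abs_of_pos (add_pos h0 h1), ← abs_mul, abs_of_pos (add_pos h0 h1)]
    have : u p = 0 ∨ u p = 1 := by generalize u p = a; revert a; decide
    rcases this with h | h
    · rw [h]; congr 1; field_simp; ring
    · rw [h, ← abs_neg]; congr 1; field_simp; ring
  rw [Finset.sum_mul, Finset.sum_congr rfl fun u _ => hterm u, ← Finset.mul_sum,
    sum_restrict p fun w => |prefixWeight W p w 0 - prefixWeight W p w 1|, ← mul_assoc, ← pow_add,
    Nat.add_sub_cancel' hn']

/-! ### The sampler with uniform frozen bits -/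

open Classical in
/-- The density, relative to uniform bits, of the sequential sampler that draws the bits of `F`
uniformly and the others from their conditional law. -/
noncomputable def samplerDensity (W : (ι → ZMod 2) → ℝ) (F : Set ι) (u : ι → ZMod 2) : ℝ :=
  ∏ p, if p ∈ F then 1 else bitRatio W p u

theorem isBitKernel_sampler {W : (ι → ZMod 2) → ℝ} (hW : ∀ u, 0 < W u) (F : Set ι)
    [DecidablePred (· ∈ F)] : IsBitKernel fun p u => if p ∈ F then 1 else bitRatio W p u where
  nonneg p u := by
    split_ifs
    · exact zero_le_one
    · exact (isBitKernel_bitRatio hW).nonneg p u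
  add_flip p u := by
    split_ifs
    · norm_num
    · exact (isBitKernel_bitRatio hW).add_flip p u
  flip_of_lt p q u h := by
    split_ifs
    · rfl
    · exact (isBitKernel_bitRatio hW).flip_of_lt p q u h

theorem samplerDensity_nonneg {W : (ι → ZMod 2) → ℝ} (hW : ∀ u, 0 < W u) (F : Set ι)
    (u : ι → ZMod 2) : 0 ≤ samplerDensity W F u := by
  classical
  exact Finset.prod_nonneg fun p _ => (isBitKernel_sampler hW F).nonneg p u

theorem sum_samplerDensity {W : (ι → ZMod 2) → ℝ} (hW : ∀ u, 0 < W u) (F : Set ι) :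
    ∑ u, samplerDensity W F u = 2 ^ Fintype.card ι := by
  classical
  have := (isBitKernel_sampler hW F).sum_mul_prod Finset.univ (fun _ => 1) (by simp)
  simp only [one_mul] at this
  unfold samplerDensity
  rw [this]
  simp [ZMod.card]

-- Frozen bits are exactly uniform under the sampler: the indicator of the fibre over `f` does not
-- depend on the other bits, so their kernels average out and only counting remains.
open Classical in
theorem sum_samplerDensity_fiber {W : (ι → ZMod 2) → ℝ} (hW : ∀ u, 0 < W u) (F : Set ι)
    (f : F → ZMod 2) :
    2 ^ Fintype.card F * ∑ u : ι → ZMod 2 with (∀ p : F, u p = f p), samplerDensity W F u =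
      2 ^ Fintype.card ι := by
  have h := (isBitKernel_bitRatio hW).sum_mul_prod (Finset.univ.filter (· ∉ F))
    (fun u => if ∀ p : F, u p = f p then 1 else 0) (by
      intro p hp u
      have hp : p ∉ F := (Finset.mem_filter.1 hp).2
      have : ∀ q : F, flipBit p u q = u q := fun q => flipBit_of_ne (by
        rintro rfl; exact hp q.2) u
      simp only [this])
  have h1 : ∀ u, samplerDensity W F u = ∏ p with p ∉ F, bitRatio W p u := by
    intro u
    unfold samplerDensity
    rw [Finset.prod_filter]
    exact Finset.prod_congr rfl fun p _ => by by_cases hp : p ∈ F <;> simp [hp]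
  rw [Finset.sum_filter]
  have h2 : ∀ u, (if ∀ p : F, u p = f p then samplerDensity W F u else 0) =
      (if ∀ p : F, u p = f p then 1 else 0) * ∏ p with p ∉ F, bitRatio W p u := by
    intro u; rw [h1]; split_ifs <;> simp
  rw [Finset.sum_congr rfl fun u _ => h2 u, h]
  rw [← Equiv.sum_comp (Equiv.piEquivPiSubtypeProd (· ∈ F) fun _ : ι => ZMod 2).symm,
    Fintype.sum_prod_type]
  have h3 : ∀ (a : {x // x ∈ F} → ZMod 2) (v : {x // x ∉ F} → ZMod 2),
      (∀ p : F, (Equiv.piEquivPiSubtypeProd (· ∈ F) fun _ : ι => ZMod 2).symm (a, v) p = f p) ↔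
        a = f := by
    intro a v
    rw [funext_iff]
    refine forall_congr' fun p => ?_
    have hp : (p : ι) ∈ F := p.2
    simp [Equiv.piEquivPiSubtypeProd, hp]
  simp only [h3]
  rw [Finset.sum_comm]
  simp only [Finset.sum_ite_eq', Finset.mem_univ, if_true, Finset.sum_const, Finset.card_univ,
    Fintype.card_fun, ZMod.card, nsmul_eq_mul, mul_one]
  have hc := Fintype.card_subtype_compl (· ∈ F)
  rw [hc]
  push_cast
  rw [← pow_add]
  congr 1
  have : Fintype.card F ≤ Fintype.card ι := Fintype.card_subtype_le _
  exact Nat.add_sub_cancel' this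

/-- Both laws are products of bit kernels that coincide off `F`, so only positions in `F` contribute
to the telescoping bound. -/
theorem sum_abs_sub_samplerDensity_le {W : (ι → ZMod 2) → ℝ} (hW : ∀ u, 0 < W u) (F : Set ι)
    [DecidablePred (· ∈ F)] :
    ∑ u, |W u - (∑ v, W v) * (samplerDensity W F u / 2 ^ Fintype.card ι)| ≤
      ∑ p with p ∈ F, ∑ w, |prefixWeight W p w 0 - prefixWeight W p w 1| := by
  classical
  have hT : 0 < ∑ v, W v := Finset.sum_pos (fun u _ => hW u) Finset.univ_nonempty
  have h := (isBitKernel_bitRatio hW).sum_abs_prod_sub_prod_le (isBitKernel_sampler hW F)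
    Finset.univ
  have hchain : ∀ u, W u = (∑ v, W v) * ((∏ p, bitRatio W p u) / 2 ^ Fintype.card ι) := by
    intro u
    have h := prod_bitRatio hW Finset.univ (by simp) u
    have hu : (Finset.univ.filter fun v : ι → ZMod 2 => ∀ q ∈ Finset.univ, v q = u q) = {u} := by
      ext v; simp [funext_iff]
    rw [hu, Finset.sum_singleton, Finset.card_univ] at h
    field_simp
    linarith
  have h1 : ∀ u, |W u - (∑ v, W v) * (samplerDensity W F u / 2 ^ Fintype.card ι)| =
      (∑ v, W v) / 2 ^ Fintype.card ι *
        |∏ p, bitRatio W p u - ∏ p, if p ∈ F then 1 else bitRatio W p u| := by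
    intro u
    nth_rewrite 1 [hchain u]
    rw [← mul_sub, ← sub_div, abs_mul, abs_div, abs_of_pos hT,
      abs_of_pos (by positivity : (0 : ℝ) < 2 ^ Fintype.card ι)]
    unfold samplerDensity
    rw [mul_div_assoc', div_mul_eq_mul_div]
    congr!
  rw [Finset.sum_congr rfl fun u _ => h1 u, ← Finset.mul_sum]
  refine (mul_le_mul_of_nonneg_left h (by positivity)).trans ?_
  rw [Finset.mul_sum, Finset.sum_filter]
  refine Finset.sum_le_sum fun p _ => ?_
  by_cases hp : p ∈ F
  · simp only [hp, if_true]
    have := sum_prod_bitRatio_mul_abs hW p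
    rw [div_mul_eq_mul_div, div_le_iff₀ (by positivity)]
    linarith
  · simp [hp]

end Sequential

end PolarQuantizer

/-! ### The polar transform and the labelling of cosets -/

namespace PolarQuantizer

/-- The 2×2 kernel is an involution over 𝔽₂, and Kronecker products respect multiplication. -/
theorem polarG_mul_self (m : ℕ) : polarG m * polarG m = 1 := by
  induction m with
  | zero => simp [polarG]
  | succ m ih =>
    have h2 : (!![1, 0; 1, 1] : Matrix (Fin 2) (Fin 2) (ZMod 2)) * !![1, 0; 1, 1] = 1 := by decide
    simp only [polarG, Matrix.reindex_apply]
    rw [Matrix.submatrix_mul_equiv]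
    have h := Matrix.mul_kronecker_mul (!![1, 0; 1, 1] : Matrix (Fin 2) (Fin 2) (ZMod 2))
      !![1, 0; 1, 1] (polarG m) (polarG m)
    rw [h2, ih, Matrix.one_kronecker_one] at h
    exact (congrArg (fun M => Matrix.submatrix M _ _) h.symm).trans (Matrix.submatrix_one_equiv _)

variable {m r : ℕ}

/-- The labels determine the bits, and are arbitrary. -/
noncomputable def labelsEquiv (m r : ℕ) : Bits m r ≃ (Fin (2 ^ m) → Fin r → ZMod 2) where
  toFun u j l := labels u l j
  invFun x p := Matrix.vecMul (fun j => x j (ofLex p).1) (polarG m) (ofLex p).2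
  left_inv u := by
    funext p
    change Matrix.vecMul (Matrix.vecMul (fun i => u (toLex ((ofLex p).1, i))) (polarG m))
      (polarG m) (ofLex p).2 = u p
    rw [Matrix.vecMul_vecMul, polarG_mul_self, Matrix.vecMul_one]
    rfl
  right_inv x := by
    funext j l
    change Matrix.vecMul (Matrix.vecMul (fun j => x j l) (polarG m)) (polarG m) j = x j l
    rw [Matrix.vecMul_vecMul, polarG_mul_self, Matrix.vecMul_one]

/-- The cosets named by the labels of all coordinates. -/
noncomputable def cosetEquiv (m r : ℕ) : Bits m r ≃ (Fin (2 ^ m) → Fin (2 ^ r)) :=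
  (labelsEquiv m r).trans (Equiv.piCongrRight fun _ =>
    (finFunctionFinEquiv : (Fin r → Fin 2) ≃ Fin (2 ^ r)))

theorem cosetEquiv_apply (u : Bits m r) (j : Fin (2 ^ m)) :
    (cosetEquiv m r u j : ℕ) = cosetRep u j := by
  refine (finFunctionFinEquiv_apply (m := 2) (n := r) (fun l => labels u l j)).trans ?_
  exact Finset.sum_congr rfl fun l _ => mul_comm _ _

/-- As the polar transform is invertible, summing over bit strings is summing over independent
choices of a coset in each coordinate, and the sum factors. -/
theorem sum_prod_cosetRep (g : Fin (2 ^ m) → ℕ → ℝ) :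
    ∑ u : Bits m r, ∏ j, g j (cosetRep u j) = ∏ j, ∑ c : Fin (2 ^ r), g j c := by
  rw [Finset.prod_univ_sum, Fintype.piFinset_univ, ← Equiv.sum_comp (cosetEquiv m r)]
  simp only [cosetEquiv_apply]

theorem cosetRep_lt (u : Bits m r) (j : Fin (2 ^ m)) : cosetRep u j < 2 ^ r := by
  rw [← cosetEquiv_apply]; exact Fin.is_lt _

end PolarQuantizer

/-! ### Gaussian sums over a lattice -/

namespace PolarQuantizer

open Real in
/-- A Gaussian of variance `s` summed over the translates of the lattice `η ℤ`. -/
theorem abs_mul_tsum_gaussianPDFReal_sub_one_le {s η : ℝ} (hs : 0 < s) (hη : 0 < η)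
    (hq : rexp (-(2 * π ^ 2 * s / η ^ 2)) ≤ 1 / 2) (z : ℝ) :
    |η * ∑' k : ℤ, gaussianPDFReal 0 s.toNNReal (η * k - z) - 1| ≤
      4 * rexp (-(2 * π ^ 2 * s / η ^ 2)) := by
  set q := rexp (-(2 * π ^ 2 * s / η ^ 2)) with hqdef
  have hq0 : 0 < q := exp_pos _
  -- The parameter of the dual theta series `f`: its term at 0 is 1, and its terms at ±(n+1) are at
  -- most q^(n+1) because (n+1)² ≥ n+1.
  obtain ⟨a, ha⟩ : ∃ a : ℝ, a = 2 * π * s / η ^ 2 := ⟨_, rfl⟩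
  have ha0 : 0 < a := by rw [ha]; positivity
  have hqa : q = rexp (-(π * a)) := by
    rw [hqdef, ha]; congr 1; ring
  let f : ℤ → ℂ := fun n =>
    Complex.exp (-π * (a : ℂ) * n ^ 2 + 2 * π * (Complex.I * (z / η : ℝ)) * n)
  have hnorm : ∀ n : ℤ, ‖f n‖ = rexp (-(π * a) * n ^ 2) := by
    intro n
    simp only [f, Complex.norm_exp]
    congr 1
    have : (-π * (a : ℂ) * n ^ 2 + 2 * π * (Complex.I * (z / η : ℝ)) * n) =
        ((-(π * a) * n ^ 2 : ℝ) : ℂ) + ((2 * π * (z / η) * n : ℝ) : ℂ) * Complex.I := by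
      push_cast; ring
    rw [this, Complex.add_re, Complex.ofReal_re, Complex.re_ofReal_mul, Complex.I_re]
    ring
  have hbound : ∀ (n : ℕ) (k : ℤ), |(k : ℝ)| = n + 1 → ‖f k‖ ≤ q * q ^ n := by
    intro n k hk
    rw [hnorm, ← sq_abs, hk, ← pow_succ', hqa, ← exp_nat_mul]
    refine exp_le_exp.2 ?_
    push_cast
    have : (0 : ℝ) ≤ π * a * (n * (n + 1)) := by positivity
    nlinarith
  have hgeo : HasSum (fun n : ℕ => q * q ^ n) (q * (1 - q)⁻¹) :=
    (hasSum_geometric_of_lt_one hq0.le (by linarith)).mul_left _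
  have hp : ∀ n : ℕ, ‖f ((n + 1 : ℕ) : ℤ)‖ ≤ q * q ^ n := fun n => hbound n _ (by
    push_cast; exact abs_of_nonneg (by positivity))
  have hm : ∀ n : ℕ, ‖f (-((n : ℤ) + 1))‖ ≤ q * q ^ n := fun n => hbound n _ (by
    push_cast; rw [abs_neg]; exact abs_of_nonneg (by positivity))
  have hsp : Summable fun n : ℕ => f ((n + 1 : ℕ) : ℤ) := .of_norm_bounded hgeo.summable hp
  have hsm : Summable fun n : ℕ => f (-((n : ℤ) + 1)) := .of_norm_bounded hgeo.summable hm
  have hsn : Summable fun n : ℕ => f n := (summable_nat_add_iff (f := fun n : ℕ => f n) 1).1 hsp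
  have hsum : ∑' n : ℤ, f n =
      1 + ∑' n : ℕ, f ((n + 1 : ℕ) : ℤ) + ∑' n : ℕ, f (-((n : ℤ) + 1)) := by
    rw [tsum_of_nat_of_neg_add_one hsn hsm, hsn.tsum_eq_zero_add]
    simp [f]
  -- Poisson summation. The translate `z` becomes a phase on the dual side, so the bound below is
  -- uniform in `z`.
  have hpois := Complex.tsum_exp_neg_quadratic (a := (a : ℂ)) (by simpa using ha0)
    (Complex.I * (z / η : ℝ))
  have hrhs : (1 / (a : ℂ) ^ (1 / 2 : ℂ) * ∑' n : ℤ,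
      Complex.exp (-π / a * (n + Complex.I * (Complex.I * (z / η : ℝ))) ^ 2)) =
        ((η * ∑' k : ℤ, gaussianPDFReal 0 s.toNNReal (η * k - z) : ℝ) : ℂ) := by
    have h1 : ∀ n : ℤ, Complex.exp (-π / a * (n + Complex.I * (Complex.I * (z / η : ℝ))) ^ 2) =
        ((rexp (-(η * n - z) ^ 2 / (2 * s)) : ℝ) : ℂ) := by
      intro n
      rw [Complex.ofReal_exp]
      congr 1
      rw [← mul_assoc, Complex.I_mul_I]
      have : (-(η * n - z) ^ 2 / (2 * s) : ℝ) = -π / a * (n - z / η) ^ 2 := by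
        rw [ha]; field_simp
      rw [this]; push_cast; ring
    have h2 : (1 / (a : ℂ) ^ (1 / 2 : ℂ)) = ((η * (√(2 * π * s))⁻¹ : ℝ) : ℂ) := by
      have : (1 / (a : ℂ) ^ (1 / 2 : ℂ)) = ((1 / a ^ (1 / 2 : ℝ) : ℝ) : ℂ) := by
        rw [Complex.ofReal_div, Complex.ofReal_cpow ha0.le]; simp
      rw [this, ← sqrt_eq_rpow, ha, sqrt_div (by positivity), sqrt_sq hη.le]
      congr 1; field_simp
    simp only [h1, h2]
    rw [← Complex.ofReal_tsum, ← Complex.ofReal_mul]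
    congr 1
    rw [mul_assoc, ← tsum_mul_left]
    congr 1
    refine tsum_congr fun k => ?_
    simp only [gaussianPDFReal, sub_zero, Real.coe_toNNReal _ hs.le]
  rw [hrhs] at hpois
  have heq : ((η * ∑' k : ℤ, gaussianPDFReal 0 s.toNNReal (η * k - z) - 1 : ℝ) : ℂ) =
      ∑' n : ℕ, f ((n + 1 : ℕ) : ℤ) + ∑' n : ℕ, f (-((n : ℤ) + 1)) := by
    rw [Complex.ofReal_sub, ← hpois, Complex.ofReal_one]
    change ∑' n : ℤ, f n - 1 = _
    rw [hsum]; ring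
  rw [← Real.norm_eq_abs, ← Complex.norm_real, heq]
  refine (norm_add_le _ _).trans ?_
  have hp' := tsum_of_norm_bounded hgeo hp
  have hm' := tsum_of_norm_bounded hgeo hm
  -- Each half of the dual series sums to at most q/(1-q) ≤ 2q, whence the constant 4.
  have : (1 - q)⁻¹ ≤ 2 := by
    rw [inv_le_comm₀ (by linarith) (by norm_num)]; linarith
  nlinarith

theorem summable_int_sq_mul_exp {a : ℝ} (ha : 0 < a) :
    Summable fun k : ℤ => (k : ℝ) ^ 2 * Real.exp (-a * (k : ℝ) ^ 2) := by
  have hq : ‖Real.exp (-a)‖ < 1 := by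
    rw [Real.norm_of_nonneg (Real.exp_pos _).le]; simpa using ha
  have hs := summable_pow_mul_geometric_of_norm_lt_one 2 hq
  have hnat : Summable fun n : ℕ => (n : ℝ) ^ 2 * Real.exp (-a * (n : ℝ) ^ 2) := by
    refine hs.of_nonneg_of_le (fun n => by positivity) fun n => ?_
    rw [← Real.exp_nat_mul]
    refine mul_le_mul_of_nonneg_left (Real.exp_le_exp.2 ?_) (by positivity)
    have : (n : ℝ) ≤ (n : ℝ) ^ 2 := by exact_mod_cast Nat.le_self_pow two_ne_zero n
    nlinarith
  refine Summable.of_nat_of_neg (by simpa using hnat) (by simpa using hnat)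

theorem summable_int_exp {a : ℝ} (ha : 0 < a) :
    Summable fun k : ℤ => Real.exp (-a * (k : ℝ) ^ 2) := by
  refine (summable_int_sq_mul_exp ha).of_norm_bounded_eventually ?_
  rw [Filter.eventually_cofinite]
  refine (Set.finite_singleton (0 : ℤ)).subset fun k hk => ?_
  by_contra hk0
  apply hk
  rw [Real.norm_of_nonneg (Real.exp_pos _).le]
  refine le_mul_of_one_le_left (Real.exp_pos _).le ?_
  have : 1 ≤ k ^ 2 := (one_le_sq_iff_one_le_abs k).2 (Int.one_le_abs hk0)
  exact_mod_cast this

end PolarQuantizer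

/-! ### The scalar test channel -/

namespace PolarQuantizer

theorem summable_sq_mul_gaussianPDFReal_lattice {v : NNReal} (hv : v ≠ 0) {η : ℝ} (hη : 0 < η) :
    Summable fun k : ℤ => (η * k) ^ 2 * gaussianPDFReal 0 v (η * k) := by
  have hv' : (0 : ℝ) < v := by positivity
  refine ((summable_int_sq_mul_exp (a := η ^ 2 / (2 * v)) (by positivity)).mul_left
    (η ^ 2 * (√(2 * Real.pi * v))⁻¹)).congr fun k => ?_
  rw [gaussianPDFReal, show -(η * k - 0) ^ 2 / (2 * v) = -(η ^ 2 / (2 * v)) * (k : ℝ) ^ 2 by ring]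
  ring

theorem summable_gaussianPDFReal_lattice {v : NNReal} (hv : v ≠ 0) {η : ℝ} (hη : 0 < η) :
    Summable fun k : ℤ => gaussianPDFReal 0 v (η * k) := by
  have hv' : (0 : ℝ) < v := by positivity
  refine ((summable_int_exp (a := η ^ 2 / (2 * v)) (by positivity)).mul_left
    (√(2 * Real.pi * v))⁻¹).congr fun k => ?_
  rw [gaussianPDFReal, show -(η * k - 0) ^ 2 / (2 * v) = -(η ^ 2 / (2 * v)) * (k : ℝ) ^ 2 by ring]

theorem integrable_mul_gaussianPDFReal_iff {x : ℝ} {v : NNReal} (hv : v ≠ 0) {h : ℝ → ℝ} :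
    Integrable (fun y => gaussianPDFReal x v y * h y) ↔ Integrable h (gaussianReal x v) := by
  rw [gaussianReal_of_var_ne_zero _ hv, integrable_withDensity_iff_integrable_smul'
    (measurable_gaussianPDF _ _) (by simp [gaussianPDF])]
  simp [smul_eq_mul]

theorem integrable_pow_gaussianReal (x : ℝ) (v : NNReal) (n : ℕ) :
    Integrable (fun y => y ^ n) (gaussianReal x v) := by
  have h := (memLp_id_gaussianReal (μ := x) (v := v) n).integrable_norm_pow' 
  refine h.mono' (by fun_prop) (ae_of_all _ fun y => ?_)
  simp

theorem integral_sq_gaussianReal (x : ℝ) (v : NNReal) :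
    ∫ y, y ^ 2 ∂gaussianReal x v = x ^ 2 + v := by
  have h := variance_eq_sub (memLp_id_gaussianReal (μ := x) (v := v) 2)
  rw [variance_id_gaussianReal] at h
  simp only [id, Pi.pow_apply, integral_id_gaussianReal] at h
  linarith

theorem integrable_affine_sq_gaussianReal (a x : ℝ) (v : NNReal) :
    Integrable (fun y => (a * y - x) ^ 2) (gaussianReal x v) := by
  have h2 := (integrable_pow_gaussianReal x v 2).const_mul (a ^ 2)
  have h1 := (integrable_pow_gaussianReal x v 1).const_mul (2 * a * x)
  refine ((h2.sub h1).add (integrable_const (x ^ 2))).congr (ae_of_all _ fun y => ?_)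
  simp only [Pi.add_apply, Pi.sub_apply]; ring

/-- The factor x² + v is kept apart because it is the second moment of the output given x. In this
form the reconstruction error depends on x only through the output power, and no moment of the
discrete Gaussian has to be computed. -/
theorem integral_affine_sq_gaussianReal (a x : ℝ) (v : NNReal) :
    ∫ y, (a * y - x) ^ 2 ∂gaussianReal x v =
      (1 - a) ^ 2 * (x ^ 2 + v) + (a ^ 2 - (1 - a) ^ 2) * v := by
  have h2 := (integrable_pow_gaussianReal x v 2).const_mul (a ^ 2)
  have h1 := (integrable_pow_gaussianReal x v 1).const_mul (2 * a * x)
  have : ∀ y : ℝ, (a * y - x) ^ 2 = a ^ 2 * y ^ 2 - 2 * a * x * y ^ 1 + x ^ 2 := fun y => by ring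
  simp only [this]
  rw [integral_add (by exact h2.sub h1) (integrable_const _), integral_sub h2 h1, integral_const_mul,
    integral_const_mul, integral_sq_gaussianReal]
  simp only [pow_one, integral_id_gaussianReal, integral_const, probReal_univ, smul_eq_mul]
  ring

section Channel

variable {σs Δ η : ℝ}

theorem discreteGaussian_pos (hΔs : Δ < σs ^ 2) (hη : 0 < η) (k : ℤ) :
    0 < discreteGaussian σs Δ η k := by
  have hv : (σs ^ 2 - Δ).toNNReal ≠ 0 := by simpa using hΔs
  exact div_pos (gaussianPDFReal_pos _ _ _ hv) ((summable_gaussianPDFReal_lattice hv hη).tsum_pos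
    (fun k => gaussianPDFReal_nonneg _ _ _) 0 (gaussianPDFReal_pos _ _ _ hv))

theorem summable_discreteGaussian (hΔs : Δ < σs ^ 2) (hη : 0 < η) :
    Summable (discreteGaussian σs Δ η) :=
  (summable_gaussianPDFReal_lattice (by simpa using hΔs) hη).div_const _

theorem summable_sq_mul_discreteGaussian (hΔs : Δ < σs ^ 2) (hη : 0 < η) :
    Summable fun k : ℤ => discreteGaussian σs Δ η k * (η * k) ^ 2 := by
  refine ((summable_sq_mul_gaussianPDFReal_lattice (v := (σs ^ 2 - Δ).toNNReal)
    (by simpa using hΔs) hη).div_const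
      (∑' t : ℤ, gaussianPDFReal 0 (σs ^ 2 - Δ).toNNReal (η * t))).congr fun k => ?_
  rw [discreteGaussian]; ring

theorem gaussianPDFReal_le (x y : ℝ) (v : NNReal) :
    gaussianPDFReal x v y ≤ (√(2 * Real.pi * v))⁻¹ := by
  refine mul_le_of_le_one_right (by positivity) (Real.exp_le_one_iff.2 ?_)
  exact div_nonpos_of_nonpos_of_nonneg (neg_nonpos.2 (sq_nonneg _)) (by positivity)

theorem continuous_gaussianPDFReal (x : ℝ) (v : NNReal) : Continuous (gaussianPDFReal x v) := by
  unfold gaussianPDFReal; fun_prop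

/-- The density of the output of the test channel. -/
noncomputable def outputDensity (σs Δ η y : ℝ) : ℝ :=
  ∑' k : ℤ, discreteGaussian σs Δ η k * gaussianPDFReal (η * k) Δ.toNNReal y

theorem summable_joint (hΔs : Δ < σs ^ 2) (hη : 0 < η) (y : ℝ) :
    Summable fun k : ℤ => discreteGaussian σs Δ η k * gaussianPDFReal (η * k) Δ.toNNReal y :=
  ((summable_discreteGaussian hΔs hη).mul_right _).of_nonneg_of_le
    (fun k => mul_nonneg (discreteGaussian_pos hΔs hη k).le (gaussianPDFReal_nonneg _ _ _))
    fun k => mul_le_mul_of_nonneg_left (gaussianPDFReal_le _ _ _)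
      (discreteGaussian_pos hΔs hη k).le

theorem injective_coset (r c : ℕ) : Function.Injective fun t : ℤ => (c : ℤ) + 2 ^ r * t :=
  fun a b h => by
    have : (2 : ℤ) ^ r ≠ 0 := by positivity
    simpa [this] using h

theorem summable_cosetDensity (hΔs : Δ < σs ^ 2) (hη : 0 < η) (r c : ℕ) (y : ℝ) :
    Summable fun t : ℤ => discreteGaussian σs Δ η (c + 2 ^ r * t) *
      gaussianPDFReal (η * ((c + 2 ^ r * t : ℤ) : ℝ)) Δ.toNNReal y :=
  (summable_joint hΔs hη y).comp_injective (injective_coset r c)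

theorem cosetDensity_pos (hΔ : 0 < Δ) (hΔs : Δ < σs ^ 2) (hη : 0 < η) (r c : ℕ) (y : ℝ) :
    0 < cosetDensity σs Δ η r c y :=
  (summable_cosetDensity hΔs hη r c y).tsum_pos
    (fun k => mul_nonneg (discreteGaussian_pos hΔs hη _).le (gaussianPDFReal_nonneg _ _ _)) 0
    (mul_pos (discreteGaussian_pos hΔs hη _) (gaussianPDFReal_pos _ _ _ (by simpa using hΔ)))

theorem continuous_cosetDensity (hΔs : Δ < σs ^ 2) (hη : 0 < η) (r c : ℕ) :
    Continuous (cosetDensity σs Δ η r c) := by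
  refine continuous_tsum (fun t => (continuous_gaussianPDFReal _ _).const_mul _)
    (((summable_discreteGaussian hΔs hη).comp_injective (injective_coset r c)).mul_right
      (√(2 * Real.pi * Δ.toNNReal))⁻¹) fun t y => ?_
  have h := discreteGaussian_pos hΔs hη (c + 2 ^ r * t)
  rw [Real.norm_of_nonneg (mul_nonneg h.le (gaussianPDFReal_nonneg _ _ _))]
  exact mul_le_mul_of_nonneg_left (gaussianPDFReal_le _ _ _) h.le

theorem sum_cosetDensity (hΔs : Δ < σs ^ 2) (hη : 0 < η) (r : ℕ) (y : ℝ) :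
    ∑ c : Fin (2 ^ r), cosetDensity σs Δ η r c y = outputDensity σs Δ η y := by
  have hs := summable_joint hΔs hη y
  unfold outputDensity
  rw [← (Int.divModEquiv (2 ^ r)).symm.tsum_eq]
  have hs' := (Int.divModEquiv (2 ^ r)).symm.summable_iff.2 hs
  have hs'' := (Equiv.prodComm (Fin (2 ^ r)) ℤ).summable_iff.2 hs'
  rw [← (Equiv.prodComm (Fin (2 ^ r)) ℤ).tsum_eq]
  refine Eq.trans ?_ hs''.tsum_prod.symm
  rw [tsum_fintype]
  refine Finset.sum_congr rfl fun c _ => tsum_congr fun t => ?_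
  have : (Int.divModEquiv (2 ^ r)).symm ((Equiv.prodComm (Fin (2 ^ r)) ℤ) (c, t)) =
      (c : ℤ) + 2 ^ r * t := by
    simp [Int.divModEquiv]; ring
  simp only [Function.comp_apply]
  rw [this]

theorem cosetDensity_le (hΔ : 0 < Δ) (hΔs : Δ < σs ^ 2) (hη : 0 < η) {r c : ℕ} (hc : c < 2 ^ r)
    (y : ℝ) : cosetDensity σs Δ η r c y ≤ outputDensity σs Δ η y := by
  obtain ⟨i, rfl⟩ : ∃ i : Fin (2 ^ r), (i : ℕ) = c := ⟨⟨c, hc⟩, rfl⟩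
  rw [← sum_cosetDensity hΔs hη r y]
  exact Finset.single_le_sum (f := fun c : Fin (2 ^ r) => cosetDensity σs Δ η r c y)
    (fun c _ => (cosetDensity_pos hΔ hΔs hη r c y).le) (Finset.mem_univ i)

theorem mmseVar_pos (hσs : 0 < σs) (hΔ : 0 < Δ) (hΔs : Δ < σs ^ 2) : 0 < mmseVar σs Δ := by
  have : 0 < σs ^ 2 - Δ := by linarith
  unfold mmseVar; positivity

theorem mmseVar_le (hσs : 0 < σs) (hΔ : 0 < Δ) (hΔs : Δ < σs ^ 2) :
    mmseVar σs Δ ≤ σs ^ 2 - Δ := by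
  unfold mmseVar
  rw [div_le_iff₀ (by positivity)]
  nlinarith

/-- Completing the square: the channel law is the source law times the law of the MMSE error. -/
theorem gaussianPDFReal_mul_gaussianPDFReal (hσs : 0 < σs) (hΔ : 0 < Δ) (hΔs : Δ < σs ^ 2)
    (x y : ℝ) :
    gaussianPDFReal 0 (σs ^ 2 - Δ).toNNReal x * gaussianPDFReal x Δ.toNNReal y =
      gaussianPDFReal 0 (σs ^ 2).toNNReal y *
        gaussianPDFReal 0 (mmseVar σs Δ).toNNReal (x - mmse σs Δ * y) := by
  have hv : 0 < σs ^ 2 - Δ := by linarith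
  have hm := mmseVar_pos hσs hΔ hΔs
  simp only [gaussianPDFReal, Real.coe_toNNReal _ hv.le, Real.coe_toNNReal _ hΔ.le,
    Real.coe_toNNReal _ (sq_nonneg σs), Real.coe_toNNReal _ hm.le]
  rw [mul_mul_mul_comm, mul_mul_mul_comm (√(2 * Real.pi * σs ^ 2))⁻¹, ← mul_inv, ← mul_inv,
    ← Real.sqrt_mul (by positivity), ← Real.sqrt_mul (by positivity), ← Real.exp_add,
    ← Real.exp_add]
  have hv' := hv.ne'
  have hr : 2 * Real.pi * (σs ^ 2 - Δ) * (2 * Real.pi * Δ) =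
      2 * Real.pi * σs ^ 2 * (2 * Real.pi * mmseVar σs Δ) := by
    unfold mmseVar; field_simp
  have he : -(x - 0) ^ 2 / (2 * (σs ^ 2 - Δ)) + -(y - x) ^ 2 / (2 * Δ) =
      -(y - 0) ^ 2 / (2 * σs ^ 2) +
        -(x - mmse σs Δ * y - 0) ^ 2 / (2 * mmseVar σs Δ) := by
    unfold mmseVar mmse; field_simp; ring
  rw [hr, he]

/-- Completing the square makes the output density the source density times S1/S2, with S1 a shifted
lattice sum of variance σ̃² and S2 the normalization of the discrete Gaussian. Both ηS1 and ηS2 are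
within 4q of 1, the second because σ_r² ≥ σ̃². Since ηS2 ≥ 1/2, the ratio is within 8q/(1/2) = 16q
of 1. The error is relative, so it can be multiplied over coordinates. -/
theorem abs_outputDensity_sub_le (hσs : 0 < σs) (hΔ : 0 < Δ) (hΔs : Δ < σs ^ 2) (hη : 0 < η)
    (hq : Real.exp (-(2 * Real.pi ^ 2 * mmseVar σs Δ / η ^ 2)) ≤ 1 / 8) (y : ℝ) :
    |outputDensity σs Δ η y - gaussianPDFReal 0 (σs ^ 2).toNNReal y| ≤
      16 * Real.exp (-(2 * Real.pi ^ 2 * mmseVar σs Δ / η ^ 2)) *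
        gaussianPDFReal 0 (σs ^ 2).toNNReal y := by
  set q := Real.exp (-(2 * Real.pi ^ 2 * mmseVar σs Δ / η ^ 2)) with hqdef
  have hv : 0 < σs ^ 2 - Δ := by linarith
  have hqv : Real.exp (-(2 * Real.pi ^ 2 * (σs ^ 2 - Δ) / η ^ 2)) ≤ q := by
    refine Real.exp_le_exp.2 (neg_le_neg ?_)
    have := mmseVar_le hσs hΔ hΔs
    gcongr
  have h1 := abs_mul_tsum_gaussianPDFReal_sub_one_le (mmseVar_pos hσs hΔ hΔs) hη
    (by rw [← hqdef]; linarith) (mmse σs Δ * y)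
  have h2 := abs_mul_tsum_gaussianPDFReal_sub_one_le hv hη (by linarith) 0
  simp only [sub_zero] at h2
  rw [← hqdef] at h1
  set S1 := ∑' k : ℤ, gaussianPDFReal 0 (mmseVar σs Δ).toNNReal (η * k - mmse σs Δ * y) with hS1
  set S2 := ∑' k : ℤ, gaussianPDFReal 0 (σs ^ 2 - Δ).toNNReal (η * k) with hS2
  have hout : outputDensity σs Δ η y = gaussianPDFReal 0 (σs ^ 2).toNNReal y * (S1 / S2) := by
    rw [mul_div_assoc', hS1, ← tsum_mul_left, ← tsum_div_const]
    refine tsum_congr fun k => ?_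
    rw [← gaussianPDFReal_mul_gaussianPDFReal hσs hΔ hΔs, discreteGaussian, div_mul_eq_mul_div]
  have hg := gaussianPDFReal_nonneg 0 (σs ^ 2).toNNReal y
  have hS2' : 1 / 2 ≤ η * S2 := by
    have := (abs_le.1 h2).1; linarith
  have hS2pos : 0 < S2 := by
    by_contra h
    have : η * S2 ≤ 0 := mul_nonpos_of_nonneg_of_nonpos hη.le (not_lt.1 h)
    linarith
  have hratio : |S1 / S2 - 1| ≤ 16 * q := by
    have : S1 / S2 - 1 = (η * S1 - η * S2) / (η * S2) := by field_simp
    rw [this, abs_div, abs_of_pos (by linarith : 0 < η * S2), div_le_iff₀ (by linarith)]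
    have h3 : |η * S1 - η * S2| ≤ 8 * q := by
      rw [abs_le] at *
      constructor <;> linarith
    have := Real.exp_pos (-(2 * Real.pi ^ 2 * mmseVar σs Δ / η ^ 2))
    nlinarith
  rw [hout, show gaussianPDFReal 0 (σs ^ 2).toNNReal y * (S1 / S2) -
    gaussianPDFReal 0 (σs ^ 2).toNNReal y =
      (S1 / S2 - 1) * gaussianPDFReal 0 (σs ^ 2).toNNReal y by ring, abs_mul, abs_of_nonneg hg]
  exact mul_le_mul_of_nonneg_right hratio hg

/-- Integrating a nonnegative weight against the joint law, one lattice point at a time. -/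
theorem hasSum_integral_cosetDensity (hΔ : 0 < Δ) (hΔs : Δ < σs ^ 2) (hη : 0 < η) (r c : ℕ)
    {h : ℤ → ℝ → ℝ} (h0 : ∀ k y, 0 ≤ h k y)
    (hint : ∀ k : ℤ, Integrable (h k) (gaussianReal (η * k) Δ.toNNReal))
    (hsum : Summable fun k : ℤ => discreteGaussian σs Δ η k *
      ∫ y, h k y ∂gaussianReal (η * k) Δ.toNNReal) :
    HasSum (fun t : ℤ => discreteGaussian σs Δ η (c + 2 ^ r * t) *
        ∫ y, h (c + 2 ^ r * t) y ∂gaussianReal (η * ((c + 2 ^ r * t : ℤ) : ℝ)) Δ.toNNReal)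
      (∫ y, ∑' t : ℤ, discreteGaussian σs Δ η (c + 2 ^ r * t) *
        gaussianPDFReal (η * ((c + 2 ^ r * t : ℤ) : ℝ)) Δ.toNNReal y * h (c + 2 ^ r * t) y) := by
  have hd : Δ.toNNReal ≠ 0 := by simpa using hΔ
  have hI : ∀ k : ℤ, ∫ y, discreteGaussian σs Δ η k *
      gaussianPDFReal (η * k) Δ.toNNReal y * h k y =
        discreteGaussian σs Δ η k * ∫ y, h k y ∂gaussianReal (η * k) Δ.toNNReal := by
    intro k
    rw [integral_gaussianReal_eq_integral_smul hd, ← integral_const_mul]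
    simp only [smul_eq_mul, mul_assoc]
  have hF : ∀ k : ℤ, Integrable fun y => discreteGaussian σs Δ η k *
      gaussianPDFReal (η * k) Δ.toNNReal y * h k y := by
    intro k
    simp only [mul_assoc]
    exact ((integrable_mul_gaussianPDFReal_iff hd).2 (hint k)).const_mul _
  have hn : ∀ k : ℤ, ∫ y, ‖discreteGaussian σs Δ η k *
      gaussianPDFReal (η * k) Δ.toNNReal y * h k y‖ =
        discreteGaussian σs Δ η k * ∫ y, h k y ∂gaussianReal (η * k) Δ.toNNReal := by
    intro k
    rw [← hI]
    refine integral_congr_ae (ae_of_all _ fun y => Real.norm_of_nonneg ?_)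
    exact mul_nonneg (mul_nonneg (discreteGaussian_pos hΔs hη k).le
      (gaussianPDFReal_nonneg _ _ _)) (h0 k y)
  have := hasSum_integral_of_summable_integral_norm (μ := volume)
    (F := fun (t : ℤ) y => discreteGaussian σs Δ η (c + 2 ^ r * t) *
        gaussianPDFReal (η * ((c + 2 ^ r * t : ℤ) : ℝ)) Δ.toNNReal y * h (c + 2 ^ r * t) y)
    (fun t => hF _) (by
      simp only [hn]
      exact hsum.comp_injective (injective_coset r c))
  simpa only [hI] using this

/-- The error of the nearest point of a coset of `η 2 ^ r ℤ`. -/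
noncomputable def cosetError (σs Δ η : ℝ) (r c : ℕ) (y : ℝ) : ℝ :=
  mmse σs Δ * y - (η * c + η * 2 ^ r * round ((mmse σs Δ * y - η * c) / (η * 2 ^ r)))

theorem abs_cosetError_le (hη : 0 < η) (r c : ℕ) (y : ℝ) (t : ℤ) :
    |cosetError σs Δ η r c y| ≤ |mmse σs Δ * y - η * ((c + 2 ^ r * t : ℤ) : ℝ)| := by
  have hL : 0 < η * 2 ^ r := by positivity
  have h := round_le ((mmse σs Δ * y - η * c) / (η * 2 ^ r)) t
  have h1 : ∀ k : ℤ, |mmse σs Δ * y - (η * c + η * 2 ^ r * k)| =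
      η * 2 ^ r * |(mmse σs Δ * y - η * c) / (η * 2 ^ r) - k| := by
    intro k
    rw [← abs_of_pos hL, ← abs_mul, abs_of_pos hL]
    congr 1; field_simp; ring
  unfold cosetError
  rw [h1, show η * ((c + 2 ^ r * t : ℤ) : ℝ) = η * c + η * 2 ^ r * t by push_cast; ring, h1]
  exact mul_le_mul_of_nonneg_left h hL.le

theorem sq_cosetError_le (hη : 0 < η) (r c : ℕ) (y : ℝ) :
    cosetError σs Δ η r c y ^ 2 ≤ (η * 2 ^ r) ^ 2 / 4 := by
  have hL : 0 < η * 2 ^ r := by positivity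
  have h := abs_sub_round ((mmse σs Δ * y - η * c) / (η * 2 ^ r))
  have h1 : cosetError σs Δ η r c y = η * 2 ^ r * ((mmse σs Δ * y - η * c) / (η * 2 ^ r) -
      round ((mmse σs Δ * y - η * c) / (η * 2 ^ r))) := by
    unfold cosetError
    rw [mul_sub, mul_div_cancel₀ _ hL.ne']; ring
  rw [h1, mul_pow, ← sq_abs (_ - _)]
  have := pow_le_pow_left₀ (abs_nonneg _) h 2
  nlinarith [sq_nonneg (η * 2 ^ r)]

theorem measurable_cosetError (r c : ℕ) : Measurable (cosetError σs Δ η r c) := by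
  unfold cosetError
  have : Measurable fun x : ℝ => ((round x : ℤ) : ℝ) := by
    simp only [round_eq]
    exact measurable_from_top.comp (Int.measurable_floor.comp (by fun_prop))
  have h2 : Measurable fun y : ℝ => (mmse σs Δ * y - η * c) / (η * 2 ^ r) := by fun_prop
  exact (measurable_id.const_mul _).sub (((this.comp h2).const_mul _).const_add _)

/-- The quantization error in a coset is controlled by the second moment of the output. -/
theorem integral_sq_cosetError_mul_le (hσs : 0 < σs) (hΔ : 0 < Δ)
    (hΔs : Δ < σs ^ 2) (hη : 0 < η) (r c : ℕ) :
    ∫ y, cosetError σs Δ η r c y ^ 2 * cosetDensity σs Δ η r c y ≤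
      (1 - mmse σs Δ) ^ 2 * (∫ y, y ^ 2 * cosetDensity σs Δ η r c y) +
        (mmse σs Δ ^ 2 - (1 - mmse σs Δ) ^ 2) * Δ * ∫ y, cosetDensity σs Δ η r c y := by
  set α := mmse σs Δ
  have hd : (Δ.toNNReal : ℝ) = Δ := Real.coe_toNNReal _ hΔ.le
  have hS := summable_discreteGaussian hΔs hη
  have hS2 := summable_sq_mul_discreteGaussian hΔs hη
  have s0 := hasSum_integral_cosetDensity hΔ hΔs hη r c (h := fun _ _ => 1)
    (fun _ _ => zero_le_one) (fun _ => integrable_const _) (by simpa using hS)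
  have s2 := hasSum_integral_cosetDensity hΔ hΔs hη r c (h := fun _ y => y ^ 2)
    (fun _ _ => sq_nonneg _) (fun _ => integrable_pow_gaussianReal _ _ _) (by
      simp only [integral_sq_gaussianReal, mul_add]
      exact hS2.add (hS.mul_right _))
  have sα := hasSum_integral_cosetDensity hΔ hΔs hη r c (h := fun k y => (α * y - η * k) ^ 2)
    (fun _ _ => sq_nonneg _) (fun _ => integrable_affine_sq_gaussianReal _ _ _) (by
      simp only [integral_affine_sq_gaussianReal]
      refine (((hS2.add (hS.mul_right (Δ.toNNReal : ℝ))).mul_left ((1 - α) ^ 2)).add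
        (hS.mul_right ((α ^ 2 - (1 - α) ^ 2) * Δ.toNNReal))).congr fun k => ?_
      ring)
  -- For each lattice point the error of the point sent is the stated combination of output power
  -- and mass. Summing gives an equality, so the only inequality in the lemma is the passage to the
  -- nearest point.
  have heq := sα.unique ((congrArg (HasSum · _) (funext fun t => by
      simp only [integral_affine_sq_gaussianReal, integral_sq_gaussianReal, hd, integral_const,
        probReal_univ, smul_eq_mul]
      ring)).mp ((s2.mul_left ((1 - α) ^ 2)).add (s0.mul_left ((α ^ 2 - (1 - α) ^ 2) * Δ))))
  have e0 : (∫ y, ∑' t : ℤ, discreteGaussian σs Δ η (c + 2 ^ r * t) *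
        gaussianPDFReal (η * ((c + 2 ^ r * t : ℤ) : ℝ)) Δ.toNNReal y * 1) =
      ∫ y, cosetDensity σs Δ η r c y := by simp only [mul_one]; rfl
  have e2 : (∫ y, ∑' t : ℤ, discreteGaussian σs Δ η (c + 2 ^ r * t) *
        gaussianPDFReal (η * ((c + 2 ^ r * t : ℤ) : ℝ)) Δ.toNNReal y * y ^ 2) =
      ∫ y, y ^ 2 * cosetDensity σs Δ η r c y := by
    simp only [tsum_mul_right]; simp only [mul_comm (_ ^ 2)]; rfl
  rw [e0, e2] at heq
  rw [← heq]
  have hα : 0 < α := div_pos (by linarith) (by positivity)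
  have hpos : ∀ k : ℤ, 0 < discreteGaussian σs Δ η k *
      ∫ y, (α * y - η * k) ^ 2 ∂gaussianReal (η * k) Δ.toNNReal := by
    intro k
    refine mul_pos (discreteGaussian_pos hΔs hη k) ?_
    rw [integral_affine_sq_gaussianReal, hd]
    have : (1 - α) ^ 2 * ((η * k) ^ 2 + Δ) + (α ^ 2 - (1 - α) ^ 2) * Δ =
        ((1 - α) * (η * k)) ^ 2 + α ^ 2 * Δ := by ring
    rw [this]; positivity
  have hint : Integrable fun y => ∑' t : ℤ, discreteGaussian σs Δ η (c + 2 ^ r * t) *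
      gaussianPDFReal (η * ((c + 2 ^ r * t : ℤ) : ℝ)) Δ.toNNReal y *
        (α * y - η * ((c + 2 ^ r * t : ℤ) : ℝ)) ^ 2 := by
    -- A non-integrable function has integral 0 by convention, so a positive integral certifies
    -- integrability.
    refine not_imp_comm.1 integral_undef (ne_of_gt ?_)
    rw [← sα.tsum_eq]
    exact sα.summable.tsum_pos (fun t => (hpos _).le) 0 (hpos _)
  refine integral_mono_of_nonneg (ae_of_all _ fun y => mul_nonneg (sq_nonneg _)
    (cosetDensity_pos hΔ hΔs hη r c y).le) hint (ae_of_all _ fun y => ?_)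
  have hw : ∀ k : ℤ, 0 ≤ discreteGaussian σs Δ η k * gaussianPDFReal (η * k) Δ.toNNReal y :=
    fun k => mul_nonneg (discreteGaussian_pos hΔs hη k).le (gaussianPDFReal_nonneg _ _ _)
  have hbig : Summable fun k : ℤ => discreteGaussian σs Δ η k *
      gaussianPDFReal (η * k) Δ.toNNReal y * (α * y - η * k) ^ 2 := by
    refine (((hS.mul_right (2 * (α * y) ^ 2)).add (hS2.mul_left 2)).mul_left
      (√(2 * Real.pi * Δ.toNNReal))⁻¹).of_nonneg_of_le
      (fun k => mul_nonneg (hw k) (sq_nonneg _)) fun k => ?_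
    have h1 := gaussianPDFReal_le (η * k) y Δ.toNNReal
    have h2 := (discreteGaussian_pos hΔs hη k).le
    have h3 : (α * y - η * k) ^ 2 ≤ 2 * (α * y) ^ 2 + 2 * (η * k) ^ 2 := by
      nlinarith [sq_nonneg (α * y + η * k)]
    calc _ ≤ discreteGaussian σs Δ η k * (√(2 * Real.pi * Δ.toNNReal))⁻¹ *
          (2 * (α * y) ^ 2 + 2 * (η * k) ^ 2) := by gcongr
      _ = _ := by ring
  simp only [cosetDensity]
  rw [← tsum_mul_left]
  refine ((summable_cosetDensity hΔs hη r c y).mul_left _).tsum_le_tsum (fun t => ?_)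
    (hbig.comp_injective (injective_coset r c))
  rw [mul_comm]
  exact mul_le_mul_of_nonneg_left (sq_le_sq.2 (abs_cosetError_le hη r c y t)) (hw _)

end Channel

end PolarQuantizer

/-! ### Independent uses of the test channel -/

namespace PolarQuantizer

/-! ### Product integrals with one weighted coordinate -/

section Product

variable {ι : Type*} [Fintype ι] [DecidableEq ι]

theorem mul_prod_eq_prod_update (p : ι → ℝ → ℝ) (j : ι) (h : ℝ → ℝ) (y : ι → ℝ) :
    h (y j) * ∏ i, p i (y i) =
      ∏ i, (Function.update p j fun x => h x * p j x) i (y i) := by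
  rw [← Finset.mul_prod_erase _ _ (Finset.mem_univ j),
    ← Finset.mul_prod_erase Finset.univ (fun i => (Function.update p j _) i (y i))
      (Finset.mem_univ j), Function.update_self, mul_assoc]
  congr 2
  refine Finset.prod_congr rfl fun i hi => ?_
  rw [Function.update_of_ne (Finset.ne_of_mem_erase hi)]

theorem integrable_mul_prod {p : ι → ℝ → ℝ} (hp : ∀ i, Integrable (p i)) (j : ι) {h : ℝ → ℝ}
    (hh : Integrable fun x => h x * p j x) :
    Integrable fun y : ι → ℝ => h (y j) * ∏ i, p i (y i) := by
  simp only [mul_prod_eq_prod_update]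
  refine Integrable.fintype_prod fun i => ?_
  by_cases hi : i = j
  · subst hi; rwa [Function.update_self]
  · rw [Function.update_of_ne hi]; exact hp i

theorem integral_mul_prod (p : ι → ℝ → ℝ) (j : ι) (h : ℝ → ℝ) :
    ∫ y : ι → ℝ, h (y j) * ∏ i, p i (y i) =
      (∫ x, h x * p j x) * ∏ i ∈ Finset.univ.erase j, ∫ x, p i x := by
  simp only [mul_prod_eq_prod_update]
  rw [integral_fintype_prod_volume_eq_prod, ← Finset.mul_prod_erase _ _ (Finset.mem_univ j),
    Function.update_self]
  congr 1
  refine Finset.prod_congr rfl fun i hi => ?_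
  rw [Function.update_of_ne (Finset.ne_of_mem_erase hi)]

end Product

variable {σs Δ η β : ℝ} {m r : ℕ}

/-- The density of the source. -/
noncomputable def sourceDensity (σs : ℝ) (m : ℕ) (y : Fin (2 ^ m) → ℝ) : ℝ :=
  ∏ j, gaussianPDFReal 0 (σs ^ 2).toNNReal (y j)

/-- The density of the output of the test channel. -/
noncomputable def outputProdDensity (σs Δ η : ℝ) (m : ℕ) (y : Fin (2 ^ m) → ℝ) : ℝ :=
  ∏ j, outputDensity σs Δ η (y j)

/-- The power of the vector `y`. -/
noncomputable def power (m : ℕ) (y : Fin (2 ^ m) → ℝ) : ℝ := 1 / (2 ^ m : ℝ) * ∑ j, y j ^ 2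

theorem power_nonneg (y : Fin (2 ^ m) → ℝ) : 0 ≤ power m y :=
  mul_nonneg (by positivity) (Finset.sum_nonneg fun _ _ => sq_nonneg _)

theorem measurable_power : Measurable (power m) := by
  unfold power; fun_prop

theorem sq_power_le (y : Fin (2 ^ m) → ℝ) : power m y ^ 2 ≤ 1 / (2 ^ m : ℝ) * ∑ j, y j ^ 4 := by
  have h := sq_sum_le_card_mul_sum_sq (s := Finset.univ) (f := fun j => y j ^ 2)
  simp only [Finset.card_univ, Fintype.card_fin, ← pow_mul] at h
  push_cast at h
  unfold power
  have hN : (0 : ℝ) < 2 ^ m := by positivity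
  rw [mul_pow, div_pow, one_pow, div_mul_eq_mul_div, div_mul_eq_mul_div, one_mul, one_mul,
    div_le_div_iff₀ (by positivity) hN]
  nlinarith

theorem measurable_sourceDensity : Measurable (sourceDensity σs m) :=
  Finset.measurable_prod _ fun j _ => (measurable_gaussianPDFReal _ _).comp (measurable_pi_apply j)

theorem sourceDensity_pos (hσs : 0 < σs) (y : Fin (2 ^ m) → ℝ) : 0 < sourceDensity σs m y :=
  Finset.prod_pos fun _ _ => gaussianPDFReal_pos _ _ _ (by simpa using hσs.ne')

theorem sourceLaw_eq_withDensity (hσs : 0 < σs) :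
    sourceLaw σs m = volume.withDensity fun y => ENNReal.ofReal (sourceDensity σs m y) := by
  have hv : (σs ^ 2).toNNReal ≠ 0 := by simpa using hσs.ne'
  refine Measure.pi_eq fun s hs => ?_
  rw [withDensity_apply _ (MeasurableSet.univ_pi hs), volume_pi, Measure.restrict_pi_pi,
    ← ofReal_integral_eq_lintegral_ofReal]
  · simp only [sourceDensity]
    rw [integral_fintype_prod_eq_prod, ENNReal.ofReal_prod_of_nonneg]
    · exact Finset.prod_congr rfl fun i _ => (gaussianReal_apply_eq_integral _ hv _).symm
    · exact fun i _ => integral_nonneg fun _ => gaussianPDFReal_nonneg _ _ _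
  · exact Integrable.fintype_prod fun i => (integrable_gaussianPDFReal _ _).restrict
  · exact ae_of_all _ fun y => (sourceDensity_pos hσs y).le

theorem integral_sourceLaw (hσs : 0 < σs) (h : (Fin (2 ^ m) → ℝ) → ℝ) :
    ∫ y, h y ∂sourceLaw σs m = ∫ y, sourceDensity σs m y * h y := by
  rw [sourceLaw_eq_withDensity hσs, integral_withDensity_eq_integral_toReal_smul
    measurable_sourceDensity.ennreal_ofReal (by simp)]
  refine integral_congr_ae (ae_of_all _ fun y => ?_)
  simp only [ENNReal.toReal_ofReal (sourceDensity_pos hσs y).le, smul_eq_mul]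

theorem integrable_coord_pow_mul_sourceDensity (hσs : 0 < σs) (j : Fin (2 ^ m)) (n : ℕ) :
    Integrable fun y : Fin (2 ^ m) → ℝ => y j ^ n * sourceDensity σs m y := by
  have hv : (σs ^ 2).toNNReal ≠ 0 := by simpa using hσs.ne'
  refine integrable_mul_prod (p := fun _ => gaussianPDFReal 0 (σs ^ 2).toNNReal)
    (fun _ => integrable_gaussianPDFReal _ _) j (h := fun x => x ^ n) ?_
  simp only [mul_comm (_ ^ n)]
  exact (integrable_mul_gaussianPDFReal_iff hv).2 (integrable_pow_gaussianReal _ _ _)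

theorem integral_coord_pow_mul_sourceDensity (hσs : 0 < σs) (j : Fin (2 ^ m)) (n : ℕ) :
    ∫ y : Fin (2 ^ m) → ℝ, y j ^ n * sourceDensity σs m y =
      ∫ x, x ^ n ∂gaussianReal 0 (σs ^ 2).toNNReal := by
  have hv : (σs ^ 2).toNNReal ≠ 0 := by simpa using hσs.ne'
  unfold sourceDensity
  rw [integral_mul_prod (fun _ => gaussianPDFReal 0 (σs ^ 2).toNNReal) j fun x => x ^ n]
  simp only [integral_gaussianPDFReal_eq_one _ hv, Finset.prod_const_one, mul_one]
  rw [integral_gaussianReal_eq_integral_smul hv]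
  simp only [smul_eq_mul, mul_comm]

theorem integrable_sourceDensity : Integrable (sourceDensity σs m) :=
  Integrable.fintype_prod fun _ => integrable_gaussianPDFReal _ _

theorem integral_sourceDensity (hσs : 0 < σs) : ∫ y, sourceDensity σs m y = 1 := by
  unfold sourceDensity
  rw [integral_fintype_prod_volume_eq_prod]
  simp [integral_gaussianPDFReal_eq_one 0 (v := (σs ^ 2).toNNReal) (by simpa using hσs.ne')]

theorem integrable_power_mul_sourceDensity (hσs : 0 < σs) :
    Integrable fun y => power m y * sourceDensity σs m y := by
  simp only [power, mul_assoc, Finset.sum_mul]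
  exact (integrable_finsetSum _ fun j _ =>
    integrable_coord_pow_mul_sourceDensity hσs j 2).const_mul _

theorem integral_power_mul_sourceDensity (hσs : 0 < σs) :
    ∫ y, power m y * sourceDensity σs m y = σs ^ 2 := by
  simp only [power, mul_assoc, Finset.sum_mul]
  rw [integral_const_mul, integral_finsetSum _ fun j _ =>
    integrable_coord_pow_mul_sourceDensity hσs j 2]
  simp only [integral_coord_pow_mul_sourceDensity hσs, integral_sq_gaussianReal]
  simp [Real.coe_toNNReal _ (sq_nonneg σs)]

theorem integrable_sq_power_mul_sourceDensity (hσs : 0 < σs) :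
    Integrable fun y => power m y ^ 2 * sourceDensity σs m y := by
  have h : Integrable fun y : Fin (2 ^ m) → ℝ =>
      1 / (2 ^ m : ℝ) * (∑ j, y j ^ 4) * sourceDensity σs m y := by
    simp only [mul_assoc, Finset.sum_mul]
    exact (integrable_finsetSum _ fun j _ =>
      integrable_coord_pow_mul_sourceDensity hσs j 4).const_mul _
  refine h.mono' ((measurable_power.pow_const 2).mul
    measurable_sourceDensity).aestronglyMeasurable (ae_of_all _ fun y => ?_)
  have hG := (sourceDensity_pos (m := m) hσs y).le
  rw [Real.norm_of_nonneg (by positivity)]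
  exact mul_le_mul_of_nonneg_right (sq_power_le y) hG

theorem integral_sq_power_mul_sourceDensity_le (hσs : 0 < σs) :
    ∫ y, power m y ^ 2 * sourceDensity σs m y ≤
      ∫ x, x ^ 4 ∂gaussianReal 0 (σs ^ 2).toNNReal := by
  have hi : Integrable fun y : Fin (2 ^ m) → ℝ =>
      1 / (2 ^ m : ℝ) * (∑ j, y j ^ 4) * sourceDensity σs m y := by
    simp only [mul_assoc, Finset.sum_mul]
    exact (integrable_finsetSum _ fun j _ =>
      integrable_coord_pow_mul_sourceDensity hσs j 4).const_mul _
  refine (integral_mono (integrable_sq_power_mul_sourceDensity hσs) hi fun y =>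
    mul_le_mul_of_nonneg_right (sq_power_le y) (sourceDensity_pos hσs y).le).trans (le_of_eq ?_)
  simp only [mul_assoc, Finset.sum_mul]
  rw [integral_const_mul, integral_finsetSum _ fun j _ =>
    integrable_coord_pow_mul_sourceDensity hσs j 4]
  simp [integral_coord_pow_mul_sourceDensity hσs]

/-- The quotient of the densities is ∏(1 + x_j) with |x_j| ≤ e, hence within exp(Ne) - 1 of 1, and
this is at most 2Ne while Ne ≤ 1. -/
theorem abs_outputProdDensity_sub_le (hσs : 0 < σs) {e : ℝ}
    (he : ∀ y, |outputDensity σs Δ η y - gaussianPDFReal 0 (σs ^ 2).toNNReal y| ≤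
      e * gaussianPDFReal 0 (σs ^ 2).toNNReal y) (hN : 2 ^ m * e ≤ 1) (y : Fin (2 ^ m) → ℝ) :
    |outputProdDensity σs Δ η m y - sourceDensity σs m y| ≤
      2 * (2 ^ m * e) * sourceDensity σs m y := by
  have hv : (σs ^ 2).toNNReal ≠ 0 := by simpa using hσs.ne'
  have hg := fun y => gaussianPDFReal_pos 0 (σs ^ 2).toNNReal y hv
  set x : Fin (2 ^ m) → ℝ := fun j =>
    (outputDensity σs Δ η (y j) - gaussianPDFReal 0 (σs ^ 2).toNNReal (y j)) /
      gaussianPDFReal 0 (σs ^ 2).toNNReal (y j) with hx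
  have hxe : ∀ j, ‖x j‖ ≤ e := fun j => by
    rw [hx, Real.norm_eq_abs, abs_div, abs_of_pos (hg _), div_le_iff₀ (hg _)]; exact he _
  have he0 : 0 ≤ e := (norm_nonneg _).trans (hxe ⟨0, by positivity⟩)
  have hprod : outputProdDensity σs Δ η m y = sourceDensity σs m y * ∏ j, (1 + x j) := by
    unfold outputProdDensity sourceDensity
    rw [← Finset.prod_mul_distrib]
    refine Finset.prod_congr rfl fun j _ => ?_
    have := (hg (y j)).ne'
    simp only [hx]; field_simp; ring
  have h1 := Finset.norm_prod_one_add_sub_one_le Finset.univ x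
  have hsum : ∑ j, ‖x j‖ ≤ 2 ^ m * e := by
    refine (Finset.sum_le_sum fun j _ => hxe j).trans (le_of_eq ?_)
    simp
  have h2 : Real.exp (∑ j, ‖x j‖) - 1 ≤ 2 * (2 ^ m * e) := by
    refine (sub_le_sub_right (Real.exp_le_exp.2 hsum) 1).trans ?_
    have h0 : 0 ≤ 2 ^ m * e := by positivity
    have := Real.abs_exp_sub_one_le (x := 2 ^ m * e) (by rwa [abs_of_nonneg h0])
    rw [abs_of_nonneg h0] at this
    exact (le_abs_self _).trans this
  have hG := sourceDensity_pos (m := m) hσs y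
  rw [hprod, show sourceDensity σs m y * ∏ j, (1 + x j) - sourceDensity σs m y =
    (∏ j, (1 + x j) - 1) * sourceDensity σs m y by ring, abs_mul, abs_of_pos hG]
  exact mul_le_mul_of_nonneg_right (h1.trans h2) hG.le

theorem jointDensity_pos (hΔ : 0 < Δ) (hΔs : Δ < σs ^ 2) (hη : 0 < η) (u : Bits m r)
    (y : Fin (2 ^ m) → ℝ) : 0 < jointDensity σs Δ η u y :=
  Finset.prod_pos fun _ _ => cosetDensity_pos hΔ hΔs hη _ _ _

theorem measurable_jointDensity (hΔs : Δ < σs ^ 2) (hη : 0 < η) (u : Bits m r) :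
    Measurable (jointDensity σs Δ η u) :=
  Finset.measurable_prod _ fun j _ =>
    (continuous_cosetDensity hΔs hη _ _).measurable.comp (measurable_pi_apply j)

theorem sum_jointDensity (hΔs : Δ < σs ^ 2) (hη : 0 < η) (y : Fin (2 ^ m) → ℝ) :
    ∑ u : Bits m r, jointDensity σs Δ η u y = outputProdDensity σs Δ η m y := by
  unfold jointDensity outputProdDensity
  rw [sum_prod_cosetRep fun j c => cosetDensity σs Δ η r c (y j)]
  simp only [sum_cosetDensity hΔs hη]

theorem measurable_outputProdDensity (hΔs : Δ < σs ^ 2) (hη : 0 < η) :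
    Measurable (outputProdDensity σs Δ η m) := by
  -- With zero levels there is a single empty bit string, whose joint density is the output density.
  have : outputProdDensity σs Δ η m =
      fun y => ∑ u : Bits m 0, jointDensity σs Δ η u y :=
    funext fun y => (sum_jointDensity hΔs hη y).symm
  rw [this]
  exact Finset.measurable_sum _ fun u _ => measurable_jointDensity hΔs hη u

theorem distortion_eq (u : Bits m r) (y : Fin (2 ^ m) → ℝ) :
    distortion σs Δ η u y =
      1 / (2 ^ m : ℝ) * ∑ j, cosetError σs Δ η r (cosetRep u j) (y j) ^ 2 := rfl

theorem distortion_nonneg (u : Bits m r) (y : Fin (2 ^ m) → ℝ) :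
    0 ≤ distortion σs Δ η u y :=
  mul_nonneg (by positivity) (Finset.sum_nonneg fun _ _ => sq_nonneg _)

theorem distortion_le (hη : 0 < η) (u : Bits m r) (y : Fin (2 ^ m) → ℝ) :
    distortion σs Δ η u y ≤ (η * 2 ^ r) ^ 2 / 4 := by
  rw [distortion_eq, one_div, inv_mul_le_iff₀ (by positivity)]
  refine (Finset.sum_le_sum fun j _ => sq_cosetError_le hη r _ _).trans (le_of_eq ?_)
  simp

theorem measurable_distortion (u : Bits m r) : Measurable (distortion σs Δ η u) := by
  have : distortion σs Δ η u = fun y =>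
      1 / (2 ^ m : ℝ) * ∑ j, cosetError σs Δ η r (cosetRep u j) (y j) ^ 2 := rfl
  rw [this]
  exact (Finset.measurable_sum _ fun j _ =>
    ((measurable_cosetError r _).comp (measurable_pi_apply j)).pow_const 2).const_mul _

theorem integrable_pow_mul_cosetDensity (hσs : 0 < σs) (hΔ : 0 < Δ) (hΔs : Δ < σs ^ 2)
    (hη : 0 < η) {e : ℝ}
    (he : ∀ y, |outputDensity σs Δ η y - gaussianPDFReal 0 (σs ^ 2).toNNReal y| ≤
      e * gaussianPDFReal 0 (σs ^ 2).toNNReal y) {c : ℕ} (hc : c < 2 ^ r) (n : ℕ) :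
    Integrable fun y => y ^ n * cosetDensity σs Δ η r c y := by
  have hv : (σs ^ 2).toNNReal ≠ 0 := by simpa using hσs.ne'
  refine ((integrable_mul_gaussianPDFReal_iff hv).2
    (integrable_pow_gaussianReal 0 _ n)).norm.const_mul (1 + e) |>.mono'
    ((measurable_id.pow_const n).mul (continuous_cosetDensity hΔs hη r c).measurable
      ).aestronglyMeasurable (ae_of_all _ fun y => ?_)
  have h1 := cosetDensity_le hΔ hΔs hη hc y
  have h2 := (abs_le.1 (he y)).2
  have h3 := gaussianPDFReal_nonneg 0 (σs ^ 2).toNNReal y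
  have h4 := (cosetDensity_pos hΔ hΔs hη r c y).le
  rw [norm_mul, norm_mul, Real.norm_of_nonneg h4, Real.norm_of_nonneg h3]
  have : ‖y ^ n‖ * cosetDensity σs Δ η r c y ≤
      ‖y ^ n‖ * ((1 + e) * gaussianPDFReal 0 (σs ^ 2).toNNReal y) :=
    mul_le_mul_of_nonneg_left (by linarith) (norm_nonneg _)
  exact this.trans (le_of_eq (by ring))

/-- For fixed `u` the joint density is a product, so the scalar bound for one coordinate is
multiplied by the masses of the others and averaged over coordinates. Holding for each `u`
separately, it may later be summed over any set of strings, in particular over those compatible with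
given frozen bits. -/
theorem integral_jointDensity_mul_distortion_le (hσs : 0 < σs) (hΔ : 0 < Δ) (hΔs : Δ < σs ^ 2)
    (hη : 0 < η) {e : ℝ}
    (he : ∀ y, |outputDensity σs Δ η y - gaussianPDFReal 0 (σs ^ 2).toNNReal y| ≤
      e * gaussianPDFReal 0 (σs ^ 2).toNNReal y) (u : Bits m r) :
    ∫ y, distortion σs Δ η u y * jointDensity σs Δ η u y ≤
      (1 - mmse σs Δ) ^ 2 * (∫ y, power m y * jointDensity σs Δ η u y) +
        (mmse σs Δ ^ 2 - (1 - mmse σs Δ) ^ 2) * Δ * ∫ y, jointDensity σs Δ η u y := by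
  set p : Fin (2 ^ m) → ℝ → ℝ := fun j => cosetDensity σs Δ η r (cosetRep u j) with hp
  have hpi : ∀ j, Integrable (p j) := fun j => by
    simpa using integrable_pow_mul_cosetDensity hσs hΔ hΔs hη he (cosetRep_lt u j) 0
  have hp2 : ∀ j, Integrable fun x => x ^ 2 * p j x := fun j =>
    integrable_pow_mul_cosetDensity hσs hΔ hΔs hη he (cosetRep_lt u j) 2
  have hpd : ∀ j, Integrable fun x => cosetError σs Δ η r (cosetRep u j) x ^ 2 * p j x := by
    intro j
    refine ((hpi j).const_mul ((η * 2 ^ r) ^ 2 / 4)).mono'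
      (((measurable_cosetError r _).pow_const 2).mul
        (continuous_cosetDensity hΔs hη r _).measurable).aestronglyMeasurable
      (ae_of_all _ fun y => ?_)
    have h4 := (cosetDensity_pos hΔ hΔs hη r (cosetRep u j) y).le
    rw [Real.norm_of_nonneg (mul_nonneg (sq_nonneg _) h4)]
    exact mul_le_mul_of_nonneg_right (sq_cosetError_le hη r _ y) h4
  have hW : ∀ y, jointDensity σs Δ η u y = ∏ j, p j (y j) := fun y => rfl
  have hterm : ∀ j, ∫ y : Fin (2 ^ m) → ℝ,
      cosetError σs Δ η r (cosetRep u j) (y j) ^ 2 * ∏ i, p i (y i) ≤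
        (1 - mmse σs Δ) ^ 2 * (∫ y : Fin (2 ^ m) → ℝ, y j ^ 2 * ∏ i, p i (y i)) +
          (mmse σs Δ ^ 2 - (1 - mmse σs Δ) ^ 2) * Δ * ∫ y : Fin (2 ^ m) → ℝ, ∏ i, p i (y i) := by
    intro j
    have h0 := integral_mul_prod p j fun _ => 1
    simp only [one_mul] at h0
    rw [integral_mul_prod p j fun x => cosetError σs Δ η r (cosetRep u j) x ^ 2,
      integral_mul_prod p j fun x => x ^ 2, h0]
    have h := integral_sq_cosetError_mul_le hσs hΔ hΔs hη r (cosetRep u j)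
    have hnn : 0 ≤ ∏ i ∈ Finset.univ.erase j, ∫ x, p i x :=
      Finset.prod_nonneg fun i _ => integral_nonneg fun x =>
        (cosetDensity_pos hΔ hΔs hη r _ x).le
    refine (mul_le_mul_of_nonneg_right h hnn).trans (le_of_eq ?_)
    ring
  simp only [distortion_eq, power, hW, mul_assoc, Finset.sum_mul]
  rw [integral_const_mul, integral_const_mul,
    integral_finsetSum _ fun j _ => integrable_mul_prod hpi j (hpd j),
    integral_finsetSum _ fun j _ => integrable_mul_prod hpi j (hp2 j)]
  have hsum := Finset.sum_le_sum fun j (_ : j ∈ Finset.univ) => hterm j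
  rw [Finset.sum_add_distrib, ← Finset.mul_sum, Finset.sum_const, Finset.card_univ,
    Fintype.card_fin, nsmul_eq_mul] at hsum
  push_cast at hsum
  rw [one_div, inv_mul_le_iff₀ (by positivity)]
  refine hsum.trans (le_of_eq ?_)
  field_simp

end PolarQuantizer

/-! ### The quantizer and the test channel -/

namespace PolarQuantizer

theorem sum_prefixWeight {ι : Type*} [Fintype ι] [LinearOrder ι] (W : (ι → ZMod 2) → ℝ) (p : ι)
    [Fintype (Set.Iio p → ZMod 2)] :
    ∑ w : Set.Iio p → ZMod 2, (prefixWeight W p w 0 + prefixWeight W p w 1) = ∑ u, W u := by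
  classical
  simp only [prefixWeight_zero_add_one]
  rw [← Finset.sum_fiberwise Finset.univ (fun u : ι → ZMod 2 => fun q : Set.Iio p => u q) W]
  refine Finset.sum_congr rfl fun w _ => Finset.sum_congr (Finset.filter_congr fun u _ => ?_)
    fun _ _ => rfl
  exact funext_iff.symm

/-- With x = √a and y = √b, AM–GM gives |x-y|(x+y) ≤ (x-y)²/(2t) + t(x+y)²/2, and (x+y)² ≤ 2(a+b).
This converts Bhattacharyya information into total variation linearly, so it can be summed and
integrated without Cauchy–Schwarz. -/
theorem abs_sub_le_of_sqrt {a b t : ℝ} (ha : 0 ≤ a) (hb : 0 ≤ b) (ht : 0 < t) :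
    |a - b| ≤ (a + b - 2 * √(a * b)) / (2 * t) + t * (a + b) := by
  rw [Real.sqrt_mul ha]
  have ha' := Real.sq_sqrt ha
  have hb' := Real.sq_sqrt hb
  have hx := Real.sqrt_nonneg a
  have hy := Real.sqrt_nonneg b
  generalize √a = x at *
  generalize √b = y at *
  rw [← ha', ← hb', div_add' _ _ _ (by positivity), le_div_iff₀ (by positivity)]
  have h : (x ^ 2 - y ^ 2) = (x - y) * (x + y) := by ring
  rw [h, abs_mul, abs_of_nonneg (add_nonneg hx hy)]
  have h1 := sq_abs (x - y)
  nlinarith [sq_nonneg (|x - y| - t * (x + y)), sq_nonneg (t * (x - y))]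

/-! ### Changing from the test-channel law to the quantizer law -/

section Error

variable {Y : Type*} {F G S W a d : Y → ℝ} {A B κ D : ℝ}

/-- The discrepancy between the law `F S` of the quantizer and the law `W` of the test channel,
weighted by the distortion. -/
def discrepancy (B D : ℝ) (F G S W a : Y → ℝ) (y : Y) : ℝ :=
  B * (|G y - F y| * S y + |W y - F y * S y|) + (a y + D) * |W y - F y * S y|

theorem discrepancy_nonneg (hB : 0 ≤ B) (hD : 0 ≤ D) (hS0 : ∀ y, 0 ≤ S y) (ha : ∀ y, 0 ≤ a y)
    (y : Y) : 0 ≤ discrepancy B D F G S W a y := by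
  have := hS0 y
  have := ha y
  unfold discrepancy; positivity

variable [MeasurableSpace Y] {μ : Measure Y}

/-- Dominated integrability against a density. -/
theorem integrable_of_abs_le (hG : Integrable G μ) {f : Y → ℝ} (hf : Measurable f) (c : ℝ)
    (h : ∀ y, |f y| ≤ c * G y) : Integrable f μ :=
  (hG.const_mul c).mono' hf.aestronglyMeasurable (ae_of_all _ h)

theorem measurable_discrepancy (hFm : Measurable F) (hGm : Measurable G) (hSm : Measurable S)
    (hWm : Measurable W) (ham : Measurable a) : Measurable (discrepancy B D F G S W a) := by
  have h1 : Measurable fun y => |G y - F y| := (hGm.sub hFm).abs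
  have h2 : Measurable fun y => |W y - F y * S y| := (hWm.sub (hFm.mul hSm)).abs
  exact (((h1.mul hSm).add h2).const_mul B).add ((ham.add_const D).mul h2)

theorem integrable_discrepancy (hFm : Measurable F) (hGm : Measurable G) (hSm : Measurable S)
    (hWm : Measurable W) (ham : Measurable a) (hS0 : ∀ y, 0 ≤ S y)
    (hS1 : ∀ y, S y ≤ 1) (hW0 : ∀ y, 0 ≤ W y) (hWF : ∀ y, W y ≤ F y) (hFG : ∀ y, F y ≤ 2 * G y)
    (hG0 : ∀ y, 0 ≤ G y) (ha : ∀ y, 0 ≤ a y) (hB : 0 ≤ B) (hD : 0 ≤ D)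
    (hGi : Integrable G μ) (haGi : Integrable (fun y => a y * G y) μ) :
    Integrable (discrepancy B D F G S W a) μ := by
  refine ((hGi.const_mul (B * 4 + D * 2)).add (haGi.const_mul 2)).mono'
    (measurable_discrepancy hFm hGm hSm hWm ham).aestronglyMeasurable (ae_of_all _ fun y => ?_)
  rw [Real.norm_of_nonneg (discrepancy_nonneg hB hD hS0 ha y)]
  have hS0 := hS0 y
  have hS1 := hS1 y
  have hW0 := hW0 y
  have hWF := hWF y
  have hFG := hFG y
  have hG0 := hG0 y
  have ha := ha y
  have hF0 : 0 ≤ F y := hW0.trans hWF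
  have h1 : |G y - F y| ≤ 2 * G y := abs_le.2 ⟨by linarith, by linarith⟩
  have hFS : F y * S y ≤ F y := mul_le_of_le_one_right hF0 hS1
  have hFS0 : 0 ≤ F y * S y := mul_nonneg hF0 hS0
  have h2 : |W y - F y * S y| ≤ 2 * G y := abs_le.2 ⟨by linarith, by linarith⟩
  have h3 : |G y - F y| * S y ≤ 2 * G y := (mul_le_of_le_one_right (abs_nonneg _) hS1).trans h1
  have h4 := mul_le_mul_of_nonneg_left (add_le_add h3 h2) hB
  have h5 := mul_le_mul_of_nonneg_left h2 (add_nonneg ha hD)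
  simp only [Pi.add_apply, discrepancy]
  linarith

/-- The distortion integral is moved from G·S to F·S to W, each exchange costing at most `B` times
the difference. The channel bound `hkey` is applied there, and its right side is moved back from W
to F·S at a cost of (a + D)·|W - F·S|. Returning to F·S lets the right side be summed exactly over a
fibre of frozen bits. -/
theorem integral_mul_mul_le_add_discrepancy (hFm : Measurable F) (hGm : Measurable G)
    (hSm : Measurable S) (hWm : Measurable W) (ham : Measurable a) (hdm : Measurable d)
    (hS0 : ∀ y, 0 ≤ S y) (hS1 : ∀ y, S y ≤ 1) (hW0 : ∀ y, 0 ≤ W y) (hWF : ∀ y, W y ≤ F y)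
    (hFG : ∀ y, F y ≤ 2 * G y) (hG0 : ∀ y, 0 ≤ G y) (ha : ∀ y, 0 ≤ a y)
    (hd0 : ∀ y, 0 ≤ d y) (hd : ∀ y, d y ≤ B) (hB : 0 ≤ B) (hA0 : 0 ≤ A) (hA1 : A ≤ 1)
    (hκ : |κ| ≤ D) (hGi : Integrable G μ) (haGi : Integrable (fun y => a y * G y) μ)
    (hkey : ∫ y, d y * W y ∂μ ≤ A * (∫ y, a y * W y ∂μ) + κ * ∫ y, W y ∂μ) :
    ∫ y, G y * (S y * d y) ∂μ ≤ A * (∫ y, a y * F y * S y ∂μ) + κ * (∫ y, F y * S y ∂μ) +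
      ∫ y, discrepancy B D F G S W a y ∂μ := by
  have hD : 0 ≤ D := (abs_nonneg κ).trans hκ
  have hF0 : ∀ y, 0 ≤ F y := fun y => (hW0 y).trans (hWF y)
  have hFS : ∀ y, F y * S y ≤ 2 * G y := fun y =>
    (mul_le_of_le_one_right (hF0 y) (hS1 y)).trans (hFG y)
  have hFS0 : ∀ y, 0 ≤ F y * S y := fun y => mul_nonneg (hF0 y) (hS0 y)
  have hWG : ∀ y, W y ≤ 2 * G y := fun y => (hWF y).trans (hFG y)
  have iW : Integrable W μ := integrable_of_abs_le hGi hWm 2 fun y => by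
    rw [abs_of_nonneg (hW0 y)]; exact hWG y
  have iFS : Integrable (fun y => F y * S y) μ :=
    integrable_of_abs_le hGi (hFm.mul hSm) 2 fun y => by
      rw [abs_of_nonneg (hFS0 y)]; exact hFS y
  have iaW : Integrable (fun y => a y * W y) μ :=
    integrable_of_abs_le haGi (ham.mul hWm) 2 fun y => by
      rw [abs_of_nonneg (mul_nonneg (ha y) (hW0 y))]
      have := mul_le_mul_of_nonneg_left (hWG y) (ha y); linarith
  have iaFS : Integrable (fun y => a y * F y * S y) μ :=
    integrable_of_abs_le haGi ((ham.mul hFm).mul hSm) 2 fun y => by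
      rw [mul_assoc, abs_of_nonneg (mul_nonneg (ha y) (hFS0 y))]
      have := mul_le_mul_of_nonneg_left (hFS y) (ha y); linarith
  have idW : Integrable (fun y => d y * W y) μ :=
    integrable_of_abs_le hGi (hdm.mul hWm) (B * 2) fun y => by
      rw [abs_of_nonneg (mul_nonneg (hd0 y) (hW0 y)), mul_assoc]
      exact mul_le_mul (hd y) (hWG y) (hW0 y) hB
  have iGSd : Integrable (fun y => G y * (S y * d y)) μ :=
    integrable_of_abs_le hGi (hGm.mul (hSm.mul hdm)) B fun y => by
      have h1 : S y * d y ≤ B :=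
        (mul_le_of_le_one_left (hd0 y) (hS1 y)).trans (hd y)
      rw [abs_of_nonneg (mul_nonneg (hG0 y) (mul_nonneg (hS0 y) (hd0 y))), mul_comm B]
      exact mul_le_mul_of_nonneg_left h1 (hG0 y)
  have iE := integrable_discrepancy (B := B) (D := D) hFm hGm hSm hWm ham hS0 hS1 hW0 hWF hFG
    hG0 ha hB hD hGi haGi
  have hpt : ∀ y, G y * (S y * d y) + (A * (a y * W y) + κ * W y) ≤
      d y * W y + (A * (a y * F y * S y) + κ * (F y * S y)) + discrepancy B D F G S W a y := by
    intro y
    have h1 : (G y - F y) * (S y * d y) ≤ B * (|G y - F y| * S y) := by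
      have := mul_le_mul (le_abs_self (G y - F y)) (le_refl (S y * d y))
        (mul_nonneg (hS0 y) (hd0 y)) (abs_nonneg _)
      have h2 := mul_le_mul_of_nonneg_left (hd y) (mul_nonneg (abs_nonneg (G y - F y)) (hS0 y))
      linarith
    have h2 : (F y * S y - W y) * d y ≤ B * |W y - F y * S y| := by
      have h3 : F y * S y - W y ≤ |W y - F y * S y| := by
        rw [abs_sub_comm]; exact le_abs_self _
      have h4 := mul_le_mul_of_nonneg_right h3 (hd0 y)
      have h5 := mul_le_mul_of_nonneg_left (hd y) (abs_nonneg (W y - F y * S y))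
      linarith
    have h3 : A * a y * (W y - F y * S y) ≤ a y * |W y - F y * S y| := by
      have h4 : A * a y ≤ a y := mul_le_of_le_one_left (ha y) hA1
      exact (mul_le_mul_of_nonneg_left (le_abs_self _) (mul_nonneg hA0 (ha y))).trans
        (mul_le_mul_of_nonneg_right h4 (abs_nonneg _))
    have h4 : κ * (W y - F y * S y) ≤ D * |W y - F y * S y| := by
      refine (le_abs_self _).trans ?_
      rw [abs_mul]
      exact mul_le_mul_of_nonneg_right hκ (abs_nonneg _)
    unfold discrepancy
    linarith
  have hint := integral_mono (iGSd.add ((iaW.const_mul A).add (iW.const_mul κ)))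
    ((idW.add ((iaFS.const_mul A).add (iFS.const_mul κ))).add iE) hpt
  simp only [Pi.add_apply] at hint
  rw [integral_add iGSd (by exact (iaW.const_mul A).add (iW.const_mul κ)),
    integral_add (iaW.const_mul A) (iW.const_mul κ),
    integral_add (by exact idW.add ((iaFS.const_mul A).add (iFS.const_mul κ))) iE,
    integral_add idW (by exact (iaFS.const_mul A).add (iFS.const_mul κ)),
    integral_add (iaFS.const_mul A) (iFS.const_mul κ), integral_const_mul, integral_const_mul,
    integral_const_mul, integral_const_mul] at hint
  linarith

end Error

/-! ### The quantizer as a conditioned sampler -/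

variable {σs Δ η β : ℝ} {m r : ℕ}

/-- The probability that the quantizer with uniform frozen bits outputs `u`. -/
noncomputable def samplerProb (σs Δ η β : ℝ) {m r : ℕ} (u : Bits m r) (y : Fin (2 ^ m) → ℝ) : ℝ :=
  samplerDensity (fun v : Bits m r => jointDensity σs Δ η v y) (frozenSet σs Δ η β m r) u /
    2 ^ Fintype.card (BitIdx m r)

theorem samplerProb_nonneg (hΔ : 0 < Δ) (hΔs : Δ < σs ^ 2) (hη : 0 < η) (u : Bits m r)
    (y : Fin (2 ^ m) → ℝ) : 0 ≤ samplerProb σs Δ η β u y :=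
  div_nonneg (samplerDensity_nonneg (fun v => jointDensity_pos hΔ hΔs hη v y) _ _) (by positivity)

theorem sum_samplerProb (hΔ : 0 < Δ) (hΔs : Δ < σs ^ 2) (hη : 0 < η)
    (y : Fin (2 ^ m) → ℝ) : ∑ u : Bits m r, samplerProb σs Δ η β u y = 1 := by
  unfold samplerProb
  rw [← Finset.sum_div, sum_samplerDensity fun v => jointDensity_pos hΔ hΔs hη v y]
  exact div_self (by positivity)

theorem samplerProb_le_one (hΔ : 0 < Δ) (hΔs : Δ < σs ^ 2) (hη : 0 < η) (u : Bits m r)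
    (y : Fin (2 ^ m) → ℝ) : samplerProb σs Δ η β u y ≤ 1 := by
  rw [← sum_samplerProb (β := β) (r := r) hΔ hΔs hη y]
  exact Finset.single_le_sum (f := fun u => samplerProb σs Δ η β u y)
    (fun v _ => samplerProb_nonneg hΔ hΔs hη v y) (Finset.mem_univ u)

theorem measurable_prefixWeight (hΔs : Δ < σs ^ 2) (hη : 0 < η) (p : BitIdx m r)
    (w : Set.Iio p → ZMod 2) (b : ZMod 2) :
    Measurable fun y => prefixWeight (fun v : Bits m r => jointDensity σs Δ η v y) p w b := by
  unfold prefixWeight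
  exact Finset.measurable_sum _ fun u _ => measurable_jointDensity hΔs hη u

theorem measurable_bitRatio (hΔs : Δ < σs ^ 2) (hη : 0 < η) (p : BitIdx m r) (u : Bits m r) :
    Measurable fun y => bitRatio (fun v : Bits m r => jointDensity σs Δ η v y) p u :=
  ((measurable_prefixWeight hΔs hη p _ _).div ((measurable_prefixWeight hΔs hη p _ _).add
    (measurable_prefixWeight hΔs hη p _ _))).const_mul 2

theorem measurable_samplerProb (hΔs : Δ < σs ^ 2) (hη : 0 < η) (u : Bits m r) :
    Measurable (samplerProb σs Δ η β u) := by
  unfold samplerProb samplerDensity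
  refine (Finset.measurable_prod _ fun p _ => ?_).div_const _
  by_cases hp : p ∈ frozenSet σs Δ η β m r
  · simp only [hp, if_true, measurable_const]
  · simp only [hp, if_false]
    exact measurable_bitRatio hΔs hη p u

-- Fixing the frozen bits is conditioning the uniform sampler on them: a copied bit has probability
-- 1 in place of 1/2, which produces the power of two.
open Classical in
theorem encoderProb_eq (f : FrozenBits σs Δ η β m r) (y : Fin (2 ^ m) → ℝ) (u : Bits m r) :
    encoderProb f y u =
      if ∀ p : frozenSet σs Δ η β m r, u p = f p then
        2 ^ Fintype.card (frozenSet σs Δ η β m r) * samplerProb σs Δ η β u y else 0 := by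
  split_ifs with h
  · have hfac : ∀ p : BitIdx m r,
        (if h : p ∈ frozenSet σs Δ η β m r then (if u p = f ⟨p, h⟩ then (1 : ℝ) else 0)
          else bitPosterior σs Δ η p (fun q => u q) (u p) y) =
        (if p ∈ frozenSet σs Δ η β m r then 1 else
          bitRatio (fun v : Bits m r => jointDensity σs Δ η v y) p u) *
          (if p ∈ frozenSet σs Δ η β m r then 2 else 1) / 2 := by
      intro p
      by_cases hp : p ∈ frozenSet σs Δ η β m r
      · simp [hp, h ⟨p, hp⟩]
      · simp only [hp, dite_false, if_false, mul_one]
        rw [eq_div_iff two_ne_zero, mul_comm]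
        rfl
    unfold encoderProb samplerProb samplerDensity
    have hpow : (∏ p : BitIdx m r, if p ∈ frozenSet σs Δ η β m r then (2 : ℝ) else 1) =
        2 ^ Fintype.card (frozenSet σs Δ η β m r) := by
      rw [← Finset.prod_filter, Finset.prod_const]
      congr 1
      exact (Fintype.card_subtype _).symm
    rw [Finset.prod_congr rfl fun p _ => hfac p, Finset.prod_div_distrib, Finset.prod_mul_distrib,
      Finset.prod_const, Finset.card_univ, hpow]
    ring
  · push Not at h
    obtain ⟨p, hp⟩ := h
    unfold encoderProb
    exact Finset.prod_eq_zero (Finset.mem_univ (p : BitIdx m r)) (by simp [hp])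

open Classical in
theorem sum_fiber_samplerProb (hΔ : 0 < Δ) (hΔs : Δ < σs ^ 2) (hη : 0 < η)
    (f : FrozenBits σs Δ η β m r) (y : Fin (2 ^ m) → ℝ) :
    2 ^ Fintype.card (frozenSet σs Δ η β m r) *
      ∑ u : Bits m r with (∀ p : frozenSet σs Δ η β m r, u p = f p), samplerProb σs Δ η β u y =
        1 := by
  have h := sum_samplerDensity_fiber (fun v : Bits m r => jointDensity_pos hΔ hΔs hη v y)
    (frozenSet σs Δ η β m r) f
  unfold samplerProb
  rw [← Finset.sum_div, mul_div_assoc', h]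
  exact div_self (by positivity)

/-- The distance between the joint law of the test channel and the law of the quantizer with
uniform frozen bits, at a given output. -/
noncomputable def samplerGap (σs Δ η β : ℝ) (m r : ℕ) (y : Fin (2 ^ m) → ℝ) : ℝ :=
  ∑ u : Bits m r,
    |jointDensity σs Δ η u y - outputProdDensity σs Δ η m y * samplerProb σs Δ η β u y|

theorem samplerGap_nonneg (y : Fin (2 ^ m) → ℝ) : 0 ≤ samplerGap σs Δ η β m r y :=
  Finset.sum_nonneg fun _ _ => abs_nonneg _

theorem measurable_samplerGap (hΔs : Δ < σs ^ 2) (hη : 0 < η) :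
    Measurable (samplerGap σs Δ η β m r) :=
  Finset.measurable_sum _ fun u _ => ((measurable_jointDensity hΔs hη u).sub
    ((measurable_outputProdDensity hΔs hη).mul (measurable_samplerProb hΔs hη u))).abs

theorem outputProdDensity_pos (hΔ : 0 < Δ) (hΔs : Δ < σs ^ 2) (hη : 0 < η)
    (y : Fin (2 ^ m) → ℝ) : 0 < outputProdDensity σs Δ η m y := by
  rw [← sum_jointDensity (r := 0) hΔs hη y]
  exact Finset.sum_pos (fun u _ => jointDensity_pos hΔ hΔs hη u y) Finset.univ_nonempty

theorem jointDensity_le (hΔ : 0 < Δ) (hΔs : Δ < σs ^ 2) (hη : 0 < η) (u : Bits m r)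
    (y : Fin (2 ^ m) → ℝ) : jointDensity σs Δ η u y ≤ outputProdDensity σs Δ η m y := by
  rw [← sum_jointDensity (r := r) hΔs hη y]
  exact Finset.single_le_sum (f := fun u => jointDensity σs Δ η u y)
    (fun v _ => (jointDensity_pos hΔ hΔs hη v y).le) (Finset.mem_univ u)

theorem samplerGap_le (hΔ : 0 < Δ) (hΔs : Δ < σs ^ 2) (hη : 0 < η) (y : Fin (2 ^ m) → ℝ) :
    samplerGap σs Δ η β m r y ≤ 2 * outputProdDensity σs Δ η m y := by
  have hF := (outputProdDensity_pos (m := m) hΔ hΔs hη y).le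
  refine (Finset.sum_le_sum fun u _ => (abs_sub _ _).trans (add_le_add
    (abs_of_pos (jointDensity_pos hΔ hΔs hη u y)).le
    (abs_of_nonneg (mul_nonneg hF (samplerProb_nonneg hΔ hΔs hη u y))).le)).trans (le_of_eq ?_)
  rw [Finset.sum_add_distrib, sum_jointDensity hΔs hη, ← Finset.mul_sum,
    sum_samplerProb hΔ hΔs hη]
  ring

/-- Every frozen position contributes ∫∑_w |D0 - D1|, which is bounded by the square-root inequality
with parameter `t`, using Z ≥ 1 - t² there. The choice t² ≥ δ balances the two terms. -/
theorem integral_samplerGap_le (hσs : 0 < σs) (hΔ : 0 < Δ) (hΔs : Δ < σs ^ 2) (hη : 0 < η)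
    {e t : ℝ} (he1 : e ≤ 1) (het : e ≤ t ^ 2) (ht : 0 < t)
    (he : ∀ y, |outputProdDensity σs Δ η m y - sourceDensity σs m y| ≤ e * sourceDensity σs m y)
    (hδ : (2 : ℝ) ^ (-((2 ^ m : ℝ) ^ β)) ≤ t ^ 2) :
    ∫ y, samplerGap σs Δ η β m r y ≤ Fintype.card (BitIdx m r) * (3 * t) := by
  classical
  have hW := fun y (u : Bits m r) => jointDensity_pos hΔ hΔs hη u y
  have hFG : ∀ y, outputProdDensity σs Δ η m y ≤ (1 + e) * sourceDensity σs m y := fun y => by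
    have := (abs_le.1 (he y)).2; linarith
  have iF : Integrable (outputProdDensity σs Δ η m) :=
    integrable_of_abs_le integrable_sourceDensity (measurable_outputProdDensity hΔs hη) (1 + e)
      fun y => by
        rw [abs_of_pos (outputProdDensity_pos hΔ hΔs hη y)]
        exact hFG y
  have hF : ∫ y, outputProdDensity σs Δ η m y ≤ 1 + e := by
    refine (integral_mono iF (integrable_sourceDensity.const_mul (1 + e)) hFG).trans (le_of_eq ?_)
    rw [integral_const_mul, integral_sourceDensity hσs, mul_one]
  set D := fun (p : BitIdx m r) (w : Set.Iio p → ZMod 2) (b : ZMod 2) (y : Fin (2 ^ m) → ℝ) =>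
    prefixWeight (fun v : Bits m r => jointDensity σs Δ η v y) p w b with hD
  have hDpos : ∀ p w b y, 0 < D p w b y := fun p w b y => prefixWeight_pos (hW y) p w b
  have hDm : ∀ p w b, Measurable (D p w b) := fun p w b => measurable_prefixWeight hΔs hη p w b
  have hDsum : ∀ p y, ∑ w, (D p w 0 y + D p w 1 y) = outputProdDensity σs Δ η m y := fun p y =>
    (sum_prefixWeight _ p).trans (sum_jointDensity hΔs hη y)
  have hDle : ∀ p w y, D p w 0 y + D p w 1 y ≤ outputProdDensity σs Δ η m y := fun p w y => by
    rw [← hDsum p y]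
    exact Finset.single_le_sum (f := fun w => D p w 0 y + D p w 1 y)
      (fun w _ => (add_pos (hDpos _ _ _ _) (hDpos _ _ _ _)).le) (Finset.mem_univ w)
  have isqrt : ∀ p w, Integrable fun y => √(D p w 0 y * D p w 1 y) := fun p w =>
    integrable_of_abs_le iF ((hDm p w 0).mul (hDm p w 1)).sqrt 1 fun y => by
      rw [abs_of_nonneg (Real.sqrt_nonneg _), one_mul]
      refine (Real.sqrt_le_sqrt ?_).trans
        ((Real.sqrt_sq (add_pos (hDpos p w 0 y) (hDpos p w 1 y)).le).le.trans (hDle p w y))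
      nlinarith [hDpos p w 0 y, hDpos p w 1 y]
  have hZ : ∀ p : BitIdx m r, bhattacharyya σs Δ η p =
      2 * ∫ y, ∑ w, √(D p w 0 y * D p w 1 y) := by
    intro p
    rw [integral_finsetSum _ fun w _ => isqrt p w]
    rfl
  have iabs : ∀ p, Integrable fun y => ∑ w, |D p w 0 y - D p w 1 y| := fun p =>
    integrable_finsetSum _ fun w _ =>
      integrable_of_abs_le iF ((hDm p w 0).sub (hDm p w 1)).abs 1 fun y => by
        rw [abs_abs, one_mul]
        refine le_trans (abs_le.2 ⟨?_, ?_⟩) (hDle p w y) <;>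
          linarith [hDpos p w 0 y, hDpos p w 1 y]
  have hp : ∀ p ∈ frozenSet σs Δ η β m r, ∫ y, ∑ w, |D p w 0 y - D p w 1 y| ≤ 3 * t := by
    intro p hp
    have hZp : 1 - (2 : ℝ) ^ (-((2 ^ m : ℝ) ^ β)) ≤ bhattacharyya σs Δ η p := not_lt.1 hp
    have isum : Integrable fun y => ∑ w, √(D p w 0 y * D p w 1 y) :=
      integrable_finsetSum _ fun w _ => isqrt p w
    have hpt : ∀ y, ∑ w, |D p w 0 y - D p w 1 y| ≤
        (1 / (2 * t) + t) * outputProdDensity σs Δ η m y -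
          1 / t * ∑ w, √(D p w 0 y * D p w 1 y) := by
      intro y
      rw [← hDsum p y, Finset.mul_sum, Finset.mul_sum, ← Finset.sum_sub_distrib]
      refine Finset.sum_le_sum fun w _ => ?_
      refine (abs_sub_le_of_sqrt (hDpos p w 0 y).le (hDpos p w 1 y).le ht).trans (le_of_eq ?_)
      field_simp
      ring
    have h := integral_mono (iabs p) ((iF.const_mul (1 / (2 * t) + t)).sub
      (isum.const_mul (1 / t))) hpt
    simp only [Pi.sub_apply] at h
    rw [integral_sub (iF.const_mul _) (isum.const_mul _), integral_const_mul,
      integral_const_mul] at h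
    refine h.trans ?_
    have hZ' : (1 - t ^ 2) / 2 ≤ ∫ y, ∑ w, √(D p w 0 y * D p w 1 y) := by
      have := hZ p; linarith
    -- The mass of the output density is bounded by 1 + t² where it is divided by `t`, so that the
    -- leading 1/(2t) cancels against the Bhattacharyya term; the crude bound 2 suffices in the
    -- other place. The total is t + 2t.
    have h1 : (1 / (2 * t) + t) * (∫ y, outputProdDensity σs Δ η m y) ≤
        (1 / (2 * t)) * (1 + t ^ 2) + t * 2 := by
      rw [add_mul]
      refine add_le_add ?_ ?_
      · exact mul_le_mul_of_nonneg_left (by linarith) (by positivity)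
      · exact mul_le_mul_of_nonneg_left (by linarith) ht.le
    have h2 : 1 / t * ((1 - t ^ 2) / 2) ≤ 1 / t * ∫ y, ∑ w, √(D p w 0 y * D p w 1 y) :=
      mul_le_mul_of_nonneg_left hZ' (by positivity)
    have h3 : (1 / (2 * t)) * (1 + t ^ 2) + t * 2 - 1 / t * ((1 - t ^ 2) / 2) = 3 * t := by
      field_simp; ring
    linarith
  have hgap : ∀ y, samplerGap σs Δ η β m r y ≤
      ∑ p with p ∈ frozenSet σs Δ η β m r, ∑ w, |D p w 0 y - D p w 1 y| := by
    intro y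
    have h := sum_abs_sub_samplerDensity_le (hW y) (frozenSet σs Δ η β m r)
    rw [sum_jointDensity hΔs hη y] at h
    exact h
  have igap : Integrable (samplerGap σs Δ η β m r) :=
    integrable_of_abs_le iF (measurable_samplerGap hΔs hη) 2 fun y => by
      rw [abs_of_nonneg (samplerGap_nonneg y)]
      exact samplerGap_le hΔ hΔs hη y
  refine (integral_mono igap (integrable_finsetSum _ fun p _ => iabs p) hgap).trans ?_
  rw [integral_finsetSum _ fun p _ => iabs p]
  refine (Finset.sum_le_sum fun p hpf => hp p (Finset.mem_filter.1 hpf).2).trans ?_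
  rw [Finset.sum_const, nsmul_eq_mul]
  refine mul_le_mul_of_nonneg_right ?_ (by positivity)
  exact_mod_cast Finset.card_le_univ _

end PolarQuantizer

/-! ### The distortion for typical frozen bits -/

namespace PolarQuantizer

variable {σs Δ η β : ℝ} {m r : ℕ}

theorem measurable_meanDistortion (hΔs : Δ < σs ^ 2) (hη : 0 < η)
    (f : FrozenBits σs Δ η β m r) : Measurable (meanDistortion f) := by
  unfold meanDistortion
  refine Finset.measurable_sum _ fun u _ => Measurable.mul ?_ (measurable_distortion u)
  simp only [encoderProb_eq]
  split_ifs
  · exact (measurable_samplerProb hΔs hη u).const_mul _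
  · exact measurable_const

theorem integrable_meanDistortion (hΔ : 0 < Δ) (hΔs : Δ < σs ^ 2) (hη : 0 < η)
    (f : FrozenBits σs Δ η β m r) : Integrable (meanDistortion f) (sourceLaw σs m) := by
  classical
  have : IsProbabilityMeasure (sourceLaw σs m) := by unfold sourceLaw; infer_instance
  refine Integrable.of_bound (measurable_meanDistortion hΔs hη f).aestronglyMeasurable
    (∑ _u : Bits m r, 2 ^ Fintype.card (frozenSet σs Δ η β m r) * ((η * 2 ^ r) ^ 2 / 4))
    (ae_of_all _ fun y => (norm_sum_le _ _).trans (Finset.sum_le_sum fun u _ => ?_))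
  have h0 := samplerProb_nonneg (β := β) hΔ hΔs hη u y
  have h1 := samplerProb_le_one (β := β) hΔ hΔs hη u y
  have hd := distortion_nonneg (σs := σs) (Δ := Δ) (η := η) u y
  rw [norm_mul, Real.norm_of_nonneg hd, encoderProb_eq]
  refine mul_le_mul ?_ (distortion_le hη u y) hd (by positivity)
  split_ifs
  · rw [Real.norm_of_nonneg (by positivity)]
    exact mul_le_of_le_one_right (by positivity) h1
  · rw [norm_zero]; positivity

/-- The loss in distortion that is due to the output `u`. -/
noncomputable def outputLoss (σs Δ η β : ℝ) {m r : ℕ} (u : Bits m r) : ℝ :=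
  ∫ y, discrepancy ((η * 2 ^ r) ^ 2 / 4) Δ (outputProdDensity σs Δ η m) (sourceDensity σs m)
    (samplerProb σs Δ η β u) (jointDensity σs Δ η u) (power m) y

theorem outputLoss_nonneg (hΔ : 0 < Δ) (hΔs : Δ < σs ^ 2) (hη : 0 < η) (u : Bits m r) :
    0 ≤ outputLoss σs Δ η β u :=
  integral_nonneg fun y => discrepancy_nonneg (by positivity) hΔ.le
    (samplerProb_nonneg hΔ hΔs hη u) power_nonneg y

theorem mmse_pos (hσs : 0 < σs) (hΔs : Δ < σs ^ 2) : 0 < mmse σs Δ :=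
  div_pos (by linarith) (by positivity)

theorem mmse_lt_one (hσs : 0 < σs) (hΔ : 0 < Δ) : mmse σs Δ < 1 := by
  unfold mmse
  rw [div_lt_one (by positivity)]
  linarith

/-- This is the channel distortion bound at output power σs², and the source of the main term. -/
theorem mmseVar_eq (hσs : 0 < σs) :
    (1 - mmse σs Δ) ^ 2 * σs ^ 2 + (mmse σs Δ ^ 2 - (1 - mmse σs Δ) ^ 2) * Δ = mmseVar σs Δ := by
  unfold mmse mmseVar
  field_simp
  ring

-- The per-string comparison is summed over the strings compatible with `f`. Since the conditioned
-- sampler has total mass 1 at every `y`, power and mass become integrals against the output density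
-- alone, within relative error `e` of σs² and 1. Only the losses still depend on `f`.
open Classical in
theorem expectedDistortion_le (hσs : 0 < σs) (hΔ : 0 < Δ) (hΔs : Δ < σs ^ 2) (hη : 0 < η)
    {e₀ e : ℝ} (he₀ : ∀ y, |outputDensity σs Δ η y - gaussianPDFReal 0 (σs ^ 2).toNNReal y| ≤
      e₀ * gaussianPDFReal 0 (σs ^ 2).toNNReal y) (he1 : e ≤ 1)
    (he : ∀ y, |outputProdDensity σs Δ η m y - sourceDensity σs m y| ≤ e * sourceDensity σs m y)
    (f : FrozenBits σs Δ η β m r) :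
    expectedDistortion f ≤ mmseVar σs Δ + (σs ^ 2 + Δ) * e +
      2 ^ Fintype.card (frozenSet σs Δ η β m r) *
        ∑ u : Bits m r with (∀ p : frozenSet σs Δ η β m r, u p = f p), outputLoss σs Δ η β u := by
  set F := outputProdDensity σs Δ η m with hFdef
  set G := sourceDensity σs m with hGdef
  set a := power m with hadef
  set n := Fintype.card (frozenSet σs Δ η β m r)
  set A := (1 - mmse σs Δ) ^ 2 with hA
  set κ := (mmse σs Δ ^ 2 - A) * Δ with hκdef
  have hα0 := mmse_pos hσs hΔs
  have hα1 := mmse_lt_one hσs hΔ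
  have hA1 : A ≤ 1 := by rw [hA]; nlinarith
  have hκ : |κ| ≤ Δ := by
    rw [hκdef, abs_mul, abs_of_pos hΔ]
    refine mul_le_of_le_one_left hΔ.le (abs_le.2 ⟨?_, ?_⟩) <;> rw [hA] <;> nlinarith
  have hG0 : ∀ y, 0 ≤ G y := fun y => (sourceDensity_pos hσs y).le
  have hF0 : ∀ y, 0 < F y := outputProdDensity_pos hΔ hΔs hη
  have hFG : ∀ y, F y ≤ 2 * G y := fun y => by
    have h1 := (abs_le.1 (he y)).2
    have h2 := mul_le_mul_of_nonneg_right he1 (hG0 y)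
    linarith
  have hGm : Measurable G := measurable_sourceDensity
  have hFm : Measurable F := measurable_outputProdDensity hΔs hη
  have iG : Integrable G := integrable_sourceDensity
  have iaG : Integrable fun y => a y * G y := integrable_power_mul_sourceDensity hσs
  have iF : Integrable F := integrable_of_abs_le iG hFm 2 fun y => by
    rw [abs_of_pos (hF0 y)]; exact hFG y
  have iaF : Integrable fun y => a y * F y :=
    integrable_of_abs_le iaG (measurable_power.mul hFm) 2 fun y => by
      rw [abs_of_nonneg (mul_nonneg (power_nonneg y) (hF0 y).le)]
      have := mul_le_mul_of_nonneg_left (hFG y) (power_nonneg y)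
      linarith
  have hS0 := fun u : Bits m r => samplerProb_nonneg (β := β) hΔ hΔs hη u
  have hS1 := fun u : Bits m r => samplerProb_le_one (β := β) hΔ hΔs hη u
  have hSm := fun u : Bits m r => measurable_samplerProb (β := β) hΔs hη u
  have iFS : ∀ u : Bits m r, Integrable fun y => F y * samplerProb σs Δ η β u y := fun u =>
    integrable_of_abs_le iF (hFm.mul (hSm u)) 1 fun y => by
      rw [abs_of_nonneg (mul_nonneg (hF0 y).le (hS0 u y)), one_mul]
      exact mul_le_of_le_one_right (hF0 y).le (hS1 u y)
  have iaFS : ∀ u : Bits m r, Integrable fun y => a y * F y * samplerProb σs Δ η β u y :=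
    fun u => integrable_of_abs_le iaF ((measurable_power.mul hFm).mul (hSm u)) 1 fun y => by
      have h := mul_nonneg (power_nonneg y) (hF0 y).le
      rw [abs_of_nonneg (mul_nonneg h (hS0 u y)), one_mul]
      exact mul_le_of_le_one_right h (hS1 u y)
  have iGSd : ∀ u : Bits m r, Integrable fun y =>
      G y * (samplerProb σs Δ η β u y * distortion σs Δ η u y) := fun u =>
    integrable_of_abs_le iG (hGm.mul ((hSm u).mul (measurable_distortion u)))
      ((η * 2 ^ r) ^ 2 / 4) fun y => by
        have hd := distortion_nonneg (σs := σs) (Δ := Δ) (η := η) u y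
        rw [abs_of_nonneg (mul_nonneg (hG0 y) (mul_nonneg (hS0 u y) hd)), mul_comm _ (G y)]
        exact mul_le_mul_of_nonneg_left ((mul_le_of_le_one_left hd (hS1 u y)).trans
          (distortion_le hη u y)) (hG0 y)
  have hD : expectedDistortion f = 2 ^ n * ∑ u : Bits m r with
      (∀ p : frozenSet σs Δ η β m r, u p = f p),
        ∫ y, G y * (samplerProb σs Δ η β u y * distortion σs Δ η u y) := by
    unfold expectedDistortion
    rw [integral_sourceLaw hσs, ← integral_finsetSum _ fun u _ => iGSd u, ← integral_const_mul]
    refine integral_congr_ae (ae_of_all _ fun y => ?_)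
    simp only [meanDistortion, encoderProb_eq, ite_mul, zero_mul]
    rw [← Finset.sum_filter, Finset.mul_sum, Finset.mul_sum]
    exact Finset.sum_congr rfl fun u _ => by ring
  have hterm : ∀ u : Bits m r,
      ∫ y, G y * (samplerProb σs Δ η β u y * distortion σs Δ η u y) ≤
        A * (∫ y, a y * F y * samplerProb σs Δ η β u y) +
          κ * (∫ y, F y * samplerProb σs Δ η β u y) + outputLoss σs Δ η β u := fun u =>
    integral_mul_mul_le_add_discrepancy hFm hGm (hSm u) (measurable_jointDensity hΔs hη u)
      measurable_power (measurable_distortion u) (hS0 u) (hS1 u)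
      (fun y => (jointDensity_pos hΔ hΔs hη u y).le) (jointDensity_le hΔ hΔs hη u) hFG hG0
      power_nonneg (distortion_nonneg u) (distortion_le hη u) (by positivity) (sq_nonneg _) hA1 hκ
      iG iaG (integral_jointDensity_mul_distortion_le hσs hΔ hΔs hη he₀ u)
  have hfib := sum_fiber_samplerProb hΔ hΔs hη f
  have hsumF : 2 ^ n * ∑ u : Bits m r with (∀ p : frozenSet σs Δ η β m r, u p = f p),
      ∫ y, F y * samplerProb σs Δ η β u y = ∫ y, F y := by
    rw [← integral_finsetSum _ fun u _ => iFS u, ← integral_const_mul]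
    refine integral_congr_ae (ae_of_all _ fun y => ?_)
    simp only
    rw [← Finset.mul_sum, mul_left_comm, hfib y, mul_one]
  have hsumaF : 2 ^ n * ∑ u : Bits m r with (∀ p : frozenSet σs Δ η β m r, u p = f p),
      ∫ y, a y * F y * samplerProb σs Δ η β u y = ∫ y, a y * F y := by
    rw [← integral_finsetSum _ fun u _ => iaFS u, ← integral_const_mul]
    refine integral_congr_ae (ae_of_all _ fun y => ?_)
    simp only
    rw [← Finset.mul_sum, mul_left_comm, hfib y, mul_one]
  have hF1 : |(∫ y, F y) - 1| ≤ e := by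
    have hG1 : ∫ y, G y = 1 := integral_sourceDensity hσs
    rw [← hG1, ← integral_sub iF iG]
    refine (abs_integral_le_integral_abs).trans ((integral_mono (iF.sub iG).abs
      (iG.const_mul e) he).trans (le_of_eq ?_))
    rw [integral_const_mul, hG1, mul_one]
  have haF : ∫ y, a y * F y ≤ (1 + e) * σs ^ 2 := by
    have haG : ∫ y, a y * G y = σs ^ 2 := integral_power_mul_sourceDensity hσs
    rw [← haG, ← integral_const_mul]
    refine integral_mono iaF (iaG.const_mul _) fun y => ?_
    have h1 := (abs_le.1 (he y)).2
    have h2 := mul_le_mul_of_nonneg_left (show F y ≤ (1 + e) * G y by linarith) (power_nonneg y)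
    simp only
    exact h2.trans (le_of_eq (by ring))
  have hsum := Finset.sum_le_sum fun (u : Bits m r) (_ : u ∈ Finset.univ.filter fun u : Bits m r =>
    ∀ p : frozenSet σs Δ η β m r, u p = f p) => hterm u
  rw [Finset.sum_add_distrib, Finset.sum_add_distrib, ← Finset.mul_sum, ← Finset.mul_sum] at hsum
  have hmain := mul_le_mul_of_nonneg_left hsum (show (0 : ℝ) ≤ 2 ^ n by positivity)
  rw [← hD, mul_add, mul_add, mul_left_comm, mul_left_comm _ κ, hsumF, hsumaF] at hmain
  refine hmain.trans (add_le_add_left ?_ _)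
  have h1 : A * (∫ y, a y * F y) ≤ A * ((1 + e) * σs ^ 2) :=
    mul_le_mul_of_nonneg_left haF (sq_nonneg _)
  have h2 : κ * (∫ y, F y) ≤ κ + Δ * e := by
    have h3 : κ * ((∫ y, F y) - 1) ≤ Δ * e := by
      refine (le_abs_self _).trans ?_
      rw [abs_mul]
      exact mul_le_mul hκ hF1 (abs_nonneg _) hΔ.le
    linarith
  have he0 : 0 ≤ e := (abs_nonneg _).trans hF1
  have h3 : A * (e * σs ^ 2) ≤ e * σs ^ 2 := mul_le_of_le_one_left (by positivity) hA1
  have h4 := mmseVar_eq (Δ := Δ) hσs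
  rw [← hA, ← hκdef] at h4
  linarith

/-- Summed over all strings, the losses involve only |G - F| and the sampler gap T, whose integral
is of order s² (taking t = s²). The one unbounded weight, the power a, is split as a ≤ 1/s + s·a²:
the first part costs ∫T/s, of order s, and the second at most 4s times a fourth moment, since T ≤
4G. -/
theorem sum_outputLoss_le (hσs : 0 < σs) (hΔ : 0 < Δ) (hΔs : Δ < σs ^ 2) (hη : 0 < η)
    {e s : ℝ} (he1 : e ≤ 1) (hs : 0 < s) (hes : e ≤ s ^ 4)
    (he : ∀ y, |outputProdDensity σs Δ η m y - sourceDensity σs m y| ≤ e * sourceDensity σs m y)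
    (hδ : (2 : ℝ) ^ (-((2 ^ m : ℝ) ^ β)) ≤ s ^ 4) :
    ∑ u : Bits m r, outputLoss σs Δ η β u ≤
      (η * 2 ^ r) ^ 2 / 4 * (s ^ 4 + Fintype.card (BitIdx m r) * (3 * s ^ 2)) +
        (Fintype.card (BitIdx m r) * (3 * s) +
          4 * s * ∫ x, x ^ 4 ∂gaussianReal 0 (σs ^ 2).toNNReal) +
        Δ * (Fintype.card (BitIdx m r) * (3 * s ^ 2)) := by
  set F := outputProdDensity σs Δ η m with hFdef
  set G := sourceDensity σs m with hGdef
  set a := power m with hadef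
  set T := samplerGap σs Δ η β m r with hTdef
  set B := (η * 2 ^ r) ^ 2 / 4 with hBdef
  have hB : 0 ≤ B := by positivity
  have hG0 : ∀ y, 0 ≤ G y := fun y => (sourceDensity_pos hσs y).le
  have hF0 : ∀ y, 0 < F y := outputProdDensity_pos hΔ hΔs hη
  have hFG : ∀ y, F y ≤ 2 * G y := fun y => by
    have h1 := (abs_le.1 (he y)).2
    have h2 := mul_le_mul_of_nonneg_right he1 (hG0 y)
    linarith
  have hGm : Measurable G := measurable_sourceDensity
  have hFm : Measurable F := measurable_outputProdDensity hΔs hη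
  have hTm : Measurable T := measurable_samplerGap hΔs hη
  have hT0 : ∀ y, 0 ≤ T y := samplerGap_nonneg
  have hTG : ∀ y, T y ≤ 4 * G y := fun y => by
    have h1 : T y ≤ 2 * F y := samplerGap_le hΔ hΔs hη y
    linarith [hFG y]
  have iG : Integrable G := integrable_sourceDensity
  have iaG : Integrable fun y => a y * G y := integrable_power_mul_sourceDensity hσs
  have ia2G : Integrable fun y => a y ^ 2 * G y := integrable_sq_power_mul_sourceDensity hσs
  have iT : Integrable T := integrable_of_abs_le iG hTm 4 fun y => by
    rw [abs_of_nonneg (hT0 y)]; exact hTG y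
  have hT : ∫ y, T y ≤ Fintype.card (BitIdx m r) * (3 * s ^ 2) :=
    integral_samplerGap_le hσs hΔ hΔs hη he1 (hes.trans_eq (by ring)) (by positivity) he
      (hδ.trans_eq (by ring))
  have hpt : ∀ y, ∑ u : Bits m r, discrepancy B Δ F G (samplerProb σs Δ η β u)
      (jointDensity σs Δ η u) a y ≤
        B * (e * G y + T y) + (T y * (1 / s) + 4 * s * (a y ^ 2 * G y)) + Δ * T y := by
    intro y
    have h1 : ∑ u : Bits m r, discrepancy B Δ F G (samplerProb σs Δ η β u)
      (jointDensity σs Δ η u) a y = B * (|G y - F y| + T y) + (a y + Δ) * T y := by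
      simp only [discrepancy, hTdef, samplerGap]
      rw [Finset.sum_add_distrib, ← Finset.mul_sum, ← Finset.mul_sum, Finset.sum_add_distrib,
        ← Finset.mul_sum, sum_samplerProb hΔ hΔs hη, mul_one]
    have h2 : B * (|G y - F y| + T y) ≤ B * (e * G y + T y) := by
      refine mul_le_mul_of_nonneg_left (add_le_add_left ?_ _) hB
      rw [abs_sub_comm]; exact he y
    have h3 : a y ≤ 1 / s + s * a y ^ 2 := by
      rw [div_add' _ _ _ hs.ne', le_div_iff₀ hs]
      nlinarith [sq_nonneg (s * a y - 1), sq_nonneg (s * a y)]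
    have h4 := mul_le_mul_of_nonneg_right h3 (hT0 y)
    have h5 := mul_le_mul_of_nonneg_left (hTG y)
      (mul_nonneg hs.le (sq_nonneg (a y)))
    rw [h1]
    linarith
  have iloss : ∀ u : Bits m r, Integrable (discrepancy B Δ F G (samplerProb σs Δ η β u)
      (jointDensity σs Δ η u) a) := fun u =>
    integrable_discrepancy hFm hGm (measurable_samplerProb hΔs hη u)
      (measurable_jointDensity hΔs hη u) measurable_power (samplerProb_nonneg hΔ hΔs hη u)
      (samplerProb_le_one hΔ hΔs hη u) (fun y => (jointDensity_pos hΔ hΔs hη u y).le)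
      (jointDensity_le hΔ hΔs hη u) hFG hG0 power_nonneg hB hΔ.le iG iaG
  have i1 : Integrable fun y => B * (e * G y + T y) := ((iG.const_mul e).add iT).const_mul B
  have i2 : Integrable fun y => T y * (1 / s) + 4 * s * (a y ^ 2 * G y) :=
    (iT.mul_const _).add (ia2G.const_mul _)
  have i3 : Integrable fun y => Δ * T y := iT.const_mul Δ
  have hint := integral_mono (integrable_finsetSum Finset.univ fun u _ => iloss u)
    ((i1.add i2).add i3) hpt
  simp only [Pi.add_apply] at hint
  rw [integral_finsetSum _ fun u _ => iloss u, integral_add (by exact i1.add i2) i3,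
    integral_add i1 i2, integral_add (iT.mul_const _) (ia2G.const_mul _), integral_const_mul,
    integral_add (iG.const_mul e) iT, integral_const_mul, integral_mul_const, integral_const_mul,
    integral_const_mul, integral_sourceDensity hσs] at hint
  refine hint.trans ?_
  have h4 : ∫ y, a y ^ 2 * G y ≤ ∫ x, x ^ 4 ∂gaussianReal 0 (σs ^ 2).toNNReal :=
    integral_sq_power_mul_sourceDensity_le hσs
  refine add_le_add (add_le_add ?_ (add_le_add ?_ ?_)) ?_
  · exact mul_le_mul_of_nonneg_left (by linarith) hB
  · refine (mul_le_mul_of_nonneg_right hT (by positivity)).trans (le_of_eq ?_)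
    field_simp
  · exact mul_le_mul_of_nonneg_left h4 (by positivity)
  · exact mul_le_mul_of_nonneg_left hT hΔ.le

/-! ### Markov's inequality and asymptotic comparison -/

/-- Markov's inequality for a uniformly distributed element. -/
theorem one_sub_le_uniformProb {A : Type} [Fintype A] [Nonempty A] {X : A → ℝ} {ε : ℝ}
    (hε : 0 < ε) (hX : ∀ x, 0 ≤ X x) (hsum : ∑ x, X x ≤ Fintype.card A * ε ^ 2) :
    1 - ε ≤ uniformProb {x | X x ≤ ε} := by
  classical
  have hcard : (0 : ℝ) < Fintype.card A := by exact_mod_cast Fintype.card_pos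
  have hsplit := Finset.card_filter_add_card_filter_not (s := (Finset.univ : Finset A))
    (fun x => X x ≤ ε)
  have hbad : ((Finset.univ.filter fun x => ¬ X x ≤ ε).card : ℝ) * ε ≤ ∑ x, X x := by
    rw [← nsmul_eq_mul]
    refine (Finset.card_nsmul_le_sum _ X ε fun x hx => ?_).trans
      (Finset.sum_le_univ_sum_of_nonneg hX)
    exact (not_le.1 (Finset.mem_filter.1 hx).2).le
  have hbad' : ((Finset.univ.filter fun x => ¬ X x ≤ ε).card : ℝ) ≤ Fintype.card A * ε := by
    refine le_of_mul_le_mul_right ?_ hε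
    exact (hbad.trans hsum).trans_eq (by ring)
  have hn : {x | X x ≤ ε}.ncard = (Finset.univ.filter fun x => X x ≤ ε).card := by
    rw [Set.ncard_eq_toFinset_card']; simp
  unfold uniformProb
  rw [hn, Nat.card_eq_fintype_card, le_div_iff₀ hcard]
  have : ((Finset.univ.filter fun x => X x ≤ ε).card : ℝ) +
      (Finset.univ.filter fun x => ¬ X x ≤ ε).card = Fintype.card A := by
    exact_mod_cast hsplit
  linarith

theorem uniformProb_mono {A : Type} [Finite A] {S T : Set A} (h : S ⊆ T) :
    uniformProb S ≤ uniformProb T := by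
  unfold uniformProb
  have := Set.ncard_le_ncard h
  gcongr

theorem eventually_add_log_add_rpow_le {b b' : ℝ} (hb : 0 < b) (hb' : b' < b) (K₁ K₂ K₃ : ℝ)
    {δ : ℝ} (hδ : 0 < δ) :
    ∀ᶠ x : ℝ in atTop, K₁ + K₂ * Real.log x + K₃ * x ^ b' ≤ δ * x ^ b := by
  have h1 : (fun _ : ℝ => K₁) =o[atTop] fun x : ℝ => x ^ b :=
    Asymptotics.isLittleO_const_left.2 (Or.inr
      (tendsto_norm_atTop_atTop.comp (tendsto_rpow_atTop hb)))
  have h2 : (fun x : ℝ => K₂ * Real.log x) =o[atTop] fun x : ℝ => x ^ b :=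
    (isLittleO_log_rpow_atTop hb).const_mul_left _
  have h3 : (fun x : ℝ => K₃ * x ^ b') =o[atTop] fun x : ℝ => x ^ b := by
    refine Asymptotics.IsLittleO.const_mul_left ?_ _
    rw [Asymptotics.isLittleO_iff_tendsto' (by
      filter_upwards [eventually_gt_atTop 0] with x hx h0
      exact absurd h0 (Real.rpow_pos_of_pos hx _).ne')]
    refine (tendsto_rpow_neg_atTop (sub_pos.2 hb')).congr' ?_
    filter_upwards [eventually_gt_atTop 0] with x hx
    rw [neg_sub, Real.rpow_sub hx]
  filter_upwards [((h1.add h2).add h3).def hδ, eventually_gt_atTop 0] with x hx hx0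
  rw [Real.norm_of_nonneg (Real.rpow_pos_of_pos hx0 _).le] at hx
  exact (le_abs_self _).trans hx

end PolarQuantizer

/-! ### Size of the total loss and conclusion -/

namespace PolarQuantizer

variable {σs Δ η β : ℝ} {m r : ℕ}

theorem card_bitIdx (m r : ℕ) : Fintype.card (BitIdx m r) = r * 2 ^ m := by
  rw [Fintype.card_lex, Fintype.card_prod, Fintype.card_fin, Fintype.card_fin]

/-- The number of bits is polynomial in the blocklength. -/
theorem card_bitIdx_le {C : ℝ} (hη : 0 < η) (hL : η * 2 ^ r = √(2 ^ m : ℝ))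
    (hC : 1 / η ^ 2 ≤ C * 2 ^ m) :
    (Fintype.card (BitIdx m r) : ℝ) ≤ |C| * (2 ^ m : ℝ) ^ 3 := by
  rw [card_bitIdx]
  push_cast
  have hN : (0 : ℝ) < 2 ^ m := by positivity
  -- A crude bound suffices: 4^r = N/η² is at most |C|N².
  have hr : (r : ℝ) ≤ (2 ^ r) ^ 2 := by
    have h1 : (r : ℝ) ≤ 2 ^ r := by exact_mod_cast Nat.lt_two_pow_self.le
    have h2 : (1 : ℝ) ≤ 2 ^ r := one_le_pow₀ (by norm_num)
    nlinarith
  have hsq : ((2 : ℝ) ^ r) ^ 2 = 2 ^ m * (1 / η ^ 2) := by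
    have : (η * 2 ^ r) ^ 2 = (2 : ℝ) ^ m := by rw [hL, Real.sq_sqrt hN.le]
    rw [← this]; field_simp
  have h3 : (2 : ℝ) ^ m * (1 / η ^ 2) ≤ 2 ^ m * (|C| * 2 ^ m) :=
    mul_le_mul_of_nonneg_left (hC.trans (mul_le_mul_of_nonneg_right (le_abs_self C) hN.le)) hN.le
  calc (r : ℝ) * 2 ^ m ≤ 2 ^ m * (|C| * 2 ^ m) * 2 ^ m :=
        mul_le_mul_of_nonneg_right (hr.trans (hsq.le.trans h3)) hN.le
    _ = _ := by ring

/-- Probability bound from a bound on the total loss. -/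
theorem one_sub_le_uniformProb_expectedDistortion (hΔ : 0 < Δ) (hΔs : Δ < σs ^ 2)
    (hη : 0 < η) {V c₀ ε : ℝ} (hc₀ : 0 ≤ c₀) (hε : 0 < ε)
    (hD : ∀ f : FrozenBits σs Δ η β m r, expectedDistortion f ≤ V + c₀ +
      open Classical in 2 ^ Fintype.card (frozenSet σs Δ η β m r) *
        ∑ u : Bits m r with (∀ p : frozenSet σs Δ η β m r, u p = f p), outputLoss σs Δ η β u)
    (hsum : c₀ + ∑ u : Bits m r, outputLoss σs Δ η β u ≤ ε ^ 2) :
    1 - ε ≤ uniformProb {f : FrozenBits σs Δ η β m r | expectedDistortion f ≤ V + ε} := by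
  classical
  set n := Fintype.card (frozenSet σs Δ η β m r) with hn
  set X : FrozenBits σs Δ η β m r → ℝ := fun f => c₀ + 2 ^ n *
    ∑ u : Bits m r with (∀ p : frozenSet σs Δ η β m r, u p = f p), outputLoss σs Δ η β u with hX
  have hX0 : ∀ f, 0 ≤ X f := fun f => add_nonneg hc₀ (mul_nonneg (by positivity)
    (Finset.sum_nonneg fun u _ => outputLoss_nonneg hΔ hΔs hη u))
  have hcard : (Fintype.card (FrozenBits σs Δ η β m r) : ℝ) = 2 ^ n := by
    rw [Fintype.card_fun, ZMod.card]; push_cast; rfl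
  have hXsum : ∑ f, X f ≤ Fintype.card (FrozenBits σs Δ η β m r) * ε ^ 2 := by
    have hfib : ∑ f : FrozenBits σs Δ η β m r,
        ∑ u : Bits m r with (∀ p : frozenSet σs Δ η β m r, u p = f p), outputLoss σs Δ η β u =
          ∑ u : Bits m r, outputLoss σs Δ η β u := by
      rw [← Finset.sum_fiberwise Finset.univ
        (fun (u : Bits m r) (p : frozenSet σs Δ η β m r) => u p)]
      refine Finset.sum_congr rfl fun f _ =>
        Finset.sum_congr (Finset.filter_congr fun u _ => ?_) fun _ _ => rfl
      exact funext_iff.symm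
    rw [hX, Finset.sum_add_distrib, ← Finset.mul_sum, hfib, Finset.sum_const, Finset.card_univ,
      nsmul_eq_mul, hcard, ← mul_add]
    exact mul_le_mul_of_nonneg_left hsum (by positivity)
  refine (one_sub_le_uniformProb hε hX0 hXsum).trans (uniformProb_mono fun f hf => ?_)
  have h1 : X f ≤ ε := hf
  have h2 := hD f
  change expectedDistortion f ≤ V + ε
  refine h2.trans ?_
  rw [add_assoc]
  exact add_le_add_right h1 V

/-- Here x is the blocklength and n the number of bits. As s ≤ 1 ≤ x, every summand is a constant
times x⁴s, the largest power coming from x·n. -/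
theorem total_loss_le {e s x n C K₄ : ℝ} (hΔ : 0 ≤ Δ) (hs : 0 < s) (hs1 : s ≤ 1)
    (hes : e ≤ s ^ 4) (hx : 1 ≤ x) (hn0 : 0 ≤ n) (hn : n ≤ C * x ^ 3)
    (hC : 0 ≤ C) (hK : 0 ≤ K₄) :
    (σs ^ 2 + Δ) * e + (x / 4 * (s ^ 4 + n * (3 * s ^ 2)) + (n * (3 * s) + 4 * s * K₄) +
      Δ * (n * (3 * s ^ 2))) ≤
        (σs ^ 2 + Δ + 1 + 4 * C + 4 * K₄ + 3 * Δ * C) * x ^ 4 * s := by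
  have h2 : s ^ 2 ≤ s := pow_le_of_le_one hs.le hs1 two_ne_zero
  have h4 : s ^ 4 ≤ s := pow_le_of_le_one hs.le hs1 four_ne_zero
  have hx0 : 0 ≤ x := by linarith
  have hx4 : 1 ≤ x ^ 4 := one_le_pow₀ hx
  have hx14 : x ≤ x ^ 4 := le_self_pow₀ hx four_ne_zero
  have hx34 : x ^ 3 ≤ x ^ 4 := pow_le_pow_right₀ hx (by norm_num)
  have hnx : n ≤ C * x ^ 4 := hn.trans (mul_le_mul_of_nonneg_left hx34 hC)
  have hxn : x * n ≤ C * x ^ 4 :=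
    (mul_le_mul_of_nonneg_left hn hx0).trans_eq (by ring)
  have t1 : (σs ^ 2 + Δ) * e ≤ (σs ^ 2 + Δ) * (x ^ 4 * s) := by
    refine mul_le_mul_of_nonneg_left ?_ (by positivity)
    nlinarith
  have t2 : x / 4 * s ^ 4 ≤ x ^ 4 * s := by
    have := mul_le_mul hx14 h4 (by positivity) (by positivity)
    nlinarith [mul_nonneg hx0 (pow_nonneg hs.le 4)]
  have t3 : x / 4 * (n * (3 * s ^ 2)) ≤ C * (x ^ 4 * s) := by
    have := mul_le_mul hxn h2 (by positivity) (by positivity)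
    nlinarith [mul_nonneg (mul_nonneg hx0 hn0) (sq_nonneg s)]
  have t4 : n * (3 * s) ≤ 3 * C * (x ^ 4 * s) := by
    have := mul_le_mul_of_nonneg_right hnx hs.le
    linarith
  have t5 : 4 * s * K₄ ≤ 4 * K₄ * (x ^ 4 * s) := by
    have := mul_le_mul_of_nonneg_right hx4 (mul_nonneg hs.le hK)
    linarith
  have t6 : Δ * (n * (3 * s ^ 2)) ≤ 3 * Δ * C * (x ^ 4 * s) := by
    have := mul_le_mul_of_nonneg_left (mul_le_mul hnx h2 (by positivity) (by positivity)) hΔ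
    linarith
  linarith

end PolarQuantizer

open PolarQuantizer

theorem mainTheorem8 (σs Δ β β' c C : ℝ) (hσs : 0 < σs) (hΔ : 0 < Δ) (hΔs : Δ < σs ^ 2)
    (hβ' : 0 < β') (hβ'β : β' < β) (hβ : β < 1 / 2) (hc : 0 < c) :
    ∀ᶠ m : ℕ in atTop, ∀ (r : ℕ) (η : ℝ), 0 < η → η * 2 ^ r = √(2 ^ m : ℝ) →
      c * 2 ^ m ≤ 1 / η ^ 2 → 1 / η ^ 2 ≤ C * 2 ^ m →
      (∀ f : PolarQuantizer.FrozenBits σs Δ η β m r,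
        Integrable (PolarQuantizer.meanDistortion f) (PolarQuantizer.sourceLaw σs m)) ∧
      1 - (2 ^ m : ℝ) ^ (2 / 3 : ℝ) * (2 : ℝ) ^ (-((2 ^ m : ℝ) ^ β') / 3) ≤
        PolarQuantizer.uniformProb {f : PolarQuantizer.FrozenBits σs Δ η β m r |
          PolarQuantizer.expectedDistortion f ≤
            PolarQuantizer.mmseVar σs Δ
              + 2 * (2 ^ m : ℝ) * (2 : ℝ) ^ (-((2 ^ m : ℝ) ^ β'))
              + (2 ^ m : ℝ) ^ (2 / 3 : ℝ) * (2 : ℝ) ^ (-((2 ^ m : ℝ) ^ β') / 3)} := by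
  set K₄ := ∫ x, x ^ 4 ∂gaussianReal 0 (σs ^ 2).toNNReal with hK₄
  have hK₄0 : 0 ≤ K₄ := integral_nonneg fun x => by positivity
  set K := σs ^ 2 + Δ + 1 + 4 * |C| + 4 * K₄ + 3 * Δ * |C| with hK
  have hK0 : 0 < K := by positivity
  have hm0 := mmseVar_pos hσs hΔ hΔs
  have hlog2 : 0 < Real.log 2 := Real.log_pos (by norm_num)
  have hx : Tendsto (fun m : ℕ => (2 : ℝ) ^ m) atTop atTop :=
    tendsto_pow_atTop_atTop_of_one_lt (by norm_num)
  -- Logarithmic form of 32·N·exp(-σ̃²cN) ≤ 2^(-N^β), which makes the Poisson error smaller than the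
  -- freezing threshold.
  have ev1 := hx.eventually (eventually_add_log_add_rpow_le one_pos (by linarith : β < 1)
    (Real.log 32) 1 (Real.log 2) (mul_pos hm0 hc))
  -- Logarithmic form of K·N⁴·2^(-N^β/4) ≤ (2^(-N^β'/3))², the condition for Markov's inequality.
  have ev2 := hx.eventually (eventually_add_log_add_rpow_le (hβ'.trans hβ'β) hβ'β
    (Real.log K) 4 (2 / 3 * Real.log 2) (by positivity : 0 < Real.log 2 / 4))
  filter_upwards [ev1, ev2] with m h1 h2 r η hη hL hcη hCη
  refine ⟨integrable_meanDistortion hΔ hΔs hη, ?_⟩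
  have hx1 : (1 : ℝ) ≤ 2 ^ m := one_le_pow₀ (by norm_num)
  have hL2 : (η * 2 ^ r) ^ 2 = (2 : ℝ) ^ m := by rw [hL, Real.sq_sqrt (by positivity)]
  have hnb := card_bitIdx_le hη hL hCη
  generalize hxdef : (2 : ℝ) ^ m = x at *
  have hx0 : 0 < x := by linarith
  set q := Real.exp (-(2 * Real.pi ^ 2 * mmseVar σs Δ / η ^ 2)) with hq
  have hq0 : 0 < q := Real.exp_pos _
  -- The fourth root of the freezing threshold: one square root is lost in passing to total
  -- variation, another in trading the power against its square.
  set s : ℝ := 2 ^ (-(x ^ β) / 4) with hs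
  have hs0 : 0 < s := by positivity
  have hs4 : s ^ 4 = 2 ^ (-(x ^ β)) := by
    rw [hs, ← Real.rpow_natCast, ← Real.rpow_mul (by norm_num)]
    congr 1; push_cast; ring
  have hs1 : s ≤ 1 := Real.rpow_le_one_of_one_le_of_nonpos (by norm_num) (by
    have : 0 < x ^ β := by positivity
    linarith)
  have hqe : 2 * (x * (16 * q)) ≤ s ^ 4 := by
    have hqx : q ≤ Real.exp (-(mmseVar σs Δ * c * x)) := by
      refine Real.exp_le_exp.2 (neg_le_neg ?_)
      have h3 : mmseVar σs Δ * (c * x) ≤ mmseVar σs Δ * (1 / η ^ 2) :=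
        mul_le_mul_of_nonneg_left hcη hm0.le
      have h4 : 1 ≤ 2 * Real.pi ^ 2 := by nlinarith [Real.pi_gt_three]
      have h5 := mul_le_mul_of_nonneg_right h4
        (mul_nonneg hm0.le (by positivity : 0 ≤ 1 / η ^ 2))
      calc mmseVar σs Δ * c * x ≤ 1 * (mmseVar σs Δ * (1 / η ^ 2)) := by linarith
        _ ≤ _ := h5
        _ = _ := by ring
    have h3 : 32 * x * Real.exp (-(mmseVar σs Δ * c * x)) ≤ s ^ 4 := by
      rw [hs4, Real.rpow_def_of_pos (by norm_num : (0 : ℝ) < 2),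
        show (32 : ℝ) * x = Real.exp (Real.log 32 + Real.log x) by
          rw [Real.exp_add, Real.exp_log (by norm_num), Real.exp_log hx0], ← Real.exp_add]
      refine Real.exp_le_exp.2 ?_
      rw [Real.rpow_one] at h1
      linarith
    have h4 := mul_le_mul_of_nonneg_left hqx (by positivity : 0 ≤ 32 * x)
    linarith
  have hs41 : s ^ 4 ≤ 1 := pow_le_one₀ hs0.le hs1
  have hxq : x * q ≤ 1 / 32 := by linarith
  have hq8 : q ≤ 1 / 8 := by nlinarith
  have he₀ := abs_outputDensity_sub_le hσs hΔ hΔs hη (hq ▸ hq8)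
  rw [← hq] at he₀
  have he : ∀ y, |outputProdDensity σs Δ η m y - sourceDensity σs m y| ≤
      2 * (x * (16 * q)) * sourceDensity σs m y := fun y => by
    rw [← hxdef]
    exact abs_outputProdDensity_sub_le hσs he₀ (by rw [hxdef]; linarith) y
  have he1 : 2 * (x * (16 * q)) ≤ 1 := hqe.trans hs41
  have hD := fun f : FrozenBits σs Δ η β m r =>
    expectedDistortion_le hσs hΔ hΔs hη he₀ he1 he f
  have hloss := sum_outputLoss_le (β := β) (r := r) hσs hΔ hΔs hη he1 hs0 hqe he
    (by rw [hxdef]; exact hs4.ge)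
  rw [hL2, ← hK₄] at hloss
  have htot := total_loss_le (σs := σs) hΔ.le hs0 hs1 hqe hx1 (Nat.cast_nonneg _) hnb
    (abs_nonneg C) hK₄0
  set ε := x ^ (2 / 3 : ℝ) * (2 : ℝ) ^ (-(x ^ β') / 3) with hε
  have hε0 : 0 < ε := by positivity
  have hε2 : K * x ^ 4 * s ≤ ε ^ 2 := by
    have h3 : K * x ^ 4 * s ≤ ((2 : ℝ) ^ (-(x ^ β') / 3)) ^ 2 := by
      rw [hs, Real.rpow_def_of_pos (by norm_num : (0 : ℝ) < 2),
        Real.rpow_def_of_pos (by norm_num : (0 : ℝ) < 2), ← Real.exp_nat_mul,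
        show K * x ^ 4 = Real.exp (Real.log K + 4 * Real.log x) by
          rw [Real.exp_add, Real.exp_log hK0, show (4 : ℝ) = ((4 : ℕ) : ℝ) by norm_num,
            Real.exp_nat_mul, Real.exp_log hx0], ← Real.exp_add]
      refine Real.exp_le_exp.2 ?_
      push_cast
      linarith
    refine h3.trans ?_
    rw [hε, mul_pow]
    exact le_mul_of_one_le_left (by positivity)
      (one_le_pow₀ (Real.one_le_rpow hx1 (by norm_num)))
  have hfin := one_sub_le_uniformProb_expectedDistortion hΔ hΔs hη
    (by positivity : 0 ≤ (σs ^ 2 + Δ) * (2 * (x * (16 * q)))) hε0 hD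
    (((add_le_add_right hloss _).trans htot).trans hε2)
  -- The deviation ε already absorbs all losses, so the nonnegative term 2N·2^(-N^β') is pure slack.
  refine hfin.trans (uniformProb_mono fun f hf => ?_)
  have hf' : expectedDistortion f ≤ mmseVar σs Δ + ε := hf
  change expectedDistortion f ≤ _
  have : 0 ≤ 2 * x * (2 : ℝ) ^ (-(x ^ β')) := by positivity
  linarith
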